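/- Let $N\in\mathbb N$, $k\in\mathbb N$ with $k\ge 1$, $\ell\in\{0,\dots,k-1\}$, $1\le p<q<\infty$, $0<\sigma<1$ and $-\ell\le\lambda\le\frac{(k+\sigma)p-\ell q}{q-p}$. For $\rho>0$ and $u\in L^1_{\mathrm{loc}}(\mathbb R^N)$ define the localized Campanato seminorm $$|u|_{\mathcal L^{1,\lambda}_{\ell,\rho}(\mathbb R^N)}=\sup_{x\in\mathbb R^N,\ r\in(0,\rho)} r^{\lambda}\inf_{P\in\mathcal P_{\ell-1}(\mathbb R^N)}\frac1{|B_r(x)|}\int_{B_r(x)}|u-P|,$$ where $\mathcal P_{\ell-1}(\mathbb R^N)$ is the space of real polynomials on $\mathbb R^N$ of degree at most $\ell-1$, with $\mathcal P_{-1}(\mathbb R^N)=\{0\}$; let $\mathcal L^{1,\lambda}_{\ell,\rho}(\mathbb R^N)$ be the set of those $u\in L^1_{\mathrm{loc}}(\mathbb R^N)$ for which it is finite. Let $W^{k+\sigma,p}(\mathbb R^N)$ be the space of real functions $u$ with weak derivatives $D^ju\in L^p(\mathbb R^N)$ for $0\le j\le k$ and with $$\int_{\mathbb R^N}\int_{\mathbb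 R^N}\frac{|D^ku(x)-D^ku(y)|^p}{|x-y|^{N+\sigma p}}\,dx\,dy<\infty.$$ Then there exists a constant $C$, depending only on $N,k,\ell,p,q,\sigma,\lambda$, such that for every $\rho>0$ and every $u\in W^{k+\sigma,p}(\mathbb R^N)\cap\mathcal L^{1,\lambda}_{\ell,\rho}(\mathbb R^N)$ one has $D^\ell u\in L^q(\mathbb R^N)$ and $$\int_{\mathbb R^N}\rho^{\ell q}|D^\ell u|^q\le C\bigl(\rho^{-\lambda}|u|_{\mathcal L^{1,\lambda}_{\ell,\rho}(\mathbb R^N)}\bigr)^{q-p}\Bigl(\rho^{p(k+\sigma)}\int_{\mathbb R^N}\int_{\mathbb R^N}\frac{|D^ku(x)-D^ku(y)|^p}{|x-y|^{N+\sigma p}}\,dx\,dy+\int_{\mathbb R^N}\rho^{\ell p}|D^\ell u|^p\Bigr).$$ -/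

import Mathlib

open MeasureTheory
open scoped ENNReal NNReal ContDiff

/-- `g` is the weak (distributional) derivative `D^j u` of order `j` of the function `u` on `ℝ^N`,
as a field of `j`-linear forms: `u` and `g` are locally integrable and, for every test function
`φ ∈ C_c^∞(ℝ^N)` and all vectors `v₁, …, v_j`,
`∫ u D^jφ[v₁, …, v_j] = (-1)^j ∫ φ g[v₁, …, v_j]`. -/
def HasWeakDeriv {N : ℕ} (j : ℕ) (u : EuclideanSpace ℝ (Fin N) → ℝ)
    (g : EuclideanSpace ℝ (Fin N) →
      ContinuousMultilinearMap ℝ (fun _ : Fin j => EuclideanSpace ℝ (Fin N)) ℝ) : Prop :=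
  LocallyIntegrable u volume ∧ LocallyIntegrable g volume ∧
    ∀ φ : EuclideanSpace ℝ (Fin N) → ℝ, ContDiff ℝ ∞ φ → HasCompactSupport φ →
      ∀ v : Fin j → EuclideanSpace ℝ (Fin N),
        ∫ x, u x * iteratedFDeriv ℝ j φ x v = (-1) ^ j * ∫ x, φ x * g x v

open Classical in
/-- The weak derivative `D^j u` (unique up to equality almost everywhere); it is `0` by convention
if `u` has no weak derivative of order `j`. -/
noncomputable def weakDeriv {N : ℕ} (j : ℕ) (u : EuclideanSpace ℝ (Fin N) → ℝ) :
    EuclideanSpace ℝ (Fin N) →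
      ContinuousMultilinearMap ℝ (fun _ : Fin j => EuclideanSpace ℝ (Fin N)) ℝ :=
  if h : ∃ g, HasWeakDeriv j u g then h.choose else 0

/-- `u ∈ W^{k,p}(ℝ^N)`: for every `j ≤ k` the weak derivative `D^j u` exists and is in `L^p`. -/
def MemSobolevW {N : ℕ} (k : ℕ) (p : ℝ) (u : EuclideanSpace ℝ (Fin N) → ℝ) : Prop :=
  ∀ j ≤ k, HasWeakDeriv j u (weakDeriv j u) ∧ MemLp (weakDeriv j u) (ENNReal.ofReal p) volume

/-- The `p`-th power of the Gagliardo seminorm of order `σ`: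
`∫∫ |F x - F y|^p / |x - y|^(N + σ p) dx dy`, with values in `[0, ∞]`. -/
noncomputable def gagliardoEnergy {N : ℕ} {G : Type*} [NormedAddCommGroup G] (σ p : ℝ)
    (F : EuclideanSpace ℝ (Fin N) → G) : ℝ≥0∞ :=
  ∫⁻ x, ∫⁻ y, ‖F x - F y‖ₑ ^ p / ‖x - y‖ₑ ^ ((N : ℝ) + σ * p)

/-- `u ∈ W^{k+σ,p}(ℝ^N)` for `0 < σ < 1`: `u ∈ W^{k,p}(ℝ^N)` and the Gagliardo seminorm of order
`σ` of `D^k u` is finite. -/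
def MemFracSobolevW {N : ℕ} (k : ℕ) (σ p : ℝ) (u : EuclideanSpace ℝ (Fin N) → ℝ) : Prop :=
  MemSobolevW k p u ∧ gagliardoEnergy σ p (weakDeriv k u) < ⊤

/-- The polynomials on `ℝ^N` of degree at most `ℓ - 1`, all of whose monomials have degree `< ℓ`;
for `ℓ = 0` this is `{0}`. -/
def polynomialsDegreeLT (N ℓ : ℕ) : Set (MvPolynomial (Fin N) ℝ) :=
  {P | ∀ m ∈ P.support, m.degree < ℓ}

/-- The localized Campanato seminorm
`sup_{x ∈ ℝ^N, 0 < r < ρ} r^lam inf_{P} ⨍_{B_r(x)} |u - P|`, the infimum being over the polynomials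
`P` of degree at most `ℓ - 1`; with values in `[0, ∞]`. -/
noncomputable def campanatoSeminorm {N : ℕ} (lam : ℝ) (ℓ : ℕ) (ρ : ℝ)
    (u : EuclideanSpace ℝ (Fin N) → ℝ) : ℝ≥0∞ :=
  ⨆ x : EuclideanSpace ℝ (Fin N), ⨆ r ∈ Set.Ioo 0 ρ,
    ENNReal.ofReal (r ^ lam) * ⨅ P ∈ polynomialsDegreeLT N ℓ,
      ⨍⁻ y in Metric.ball x r, ‖u y - MvPolynomial.eval (fun i => y i) P‖ₑ ∂volume

/-- `u` is in the localized Campanato space: it is locally integrable with finite seminorm. -/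
def MemCampanato {N : ℕ} (lam : ℝ) (ℓ : ℕ) (ρ : ℝ) (u : EuclideanSpace ℝ (Fin N) → ℝ) : Prop :=
  LocallyIntegrable u volume ∧ campanatoSeminorm lam ℓ ρ u < ⊤

/-! The core is a pointwise interpolation, `exists_ae_enorm_weakDeriv_le`: for almost every x and
every 0 < r < ρ, |D^ℓ u(x)| ≤ K (r^(-ℓ-λ) M + r^(k-ℓ+σ) E(x)), where M is the Campanato seminorm and
E(x)^p is the inner Gagliardo integral of D^k u at x.

To prove it, expand D^ℓ u by Taylor's formula along the rays from x. Fixed weights at the points x +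
τ_i r h reproduce the value at x for polynomials of degree at most k-ℓ, so only the oscillation of
D^k u along the ray is left as error. Averaging over h against a bump does two things. In the main
terms, the ℓ derivatives move to the bump, which sees u only modulo polynomials of degree less than
ℓ, whence M (`exists_enorm_integral_bump_mul_le_campanatoSeminorm`). In the error, Hölder's
inequality produces E (`exists_lintegral_bump_mul_le_localGagliardo`). The argument runs on
mollifications with uniform constants, and Lebesgue differentiation removes the mollifier.

Optimizing over r (`exists_rpow_le_of_forall_scale_le`) gives |D^ℓ u|^q ≤ C M^(q-p) (E^p + |D^ℓ
u|^p) after normalizing to ρ = 1. The last term covers the points where the balancing scale is not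
below ρ. The upper bound on λ makes the resulting power of E / M at most p. Integration in x
concludes. -/

/-! ### Polynomials and derivatives of test functions. -/

/-- A polynomial in `N` variables as a function on `ℝ^N` has the expected derivative. -/
theorem hasFDerivAt_eval_euclidean {N : ℕ} (P : MvPolynomial (Fin N) ℝ)
    (x : EuclideanSpace ℝ (Fin N)) :
    HasFDerivAt (fun y : EuclideanSpace ℝ (Fin N) => MvPolynomial.eval (fun i => y i) P)
      (∑ i, MvPolynomial.eval (fun i => x i) (MvPolynomial.pderiv i P) •
        (EuclideanSpace.proj i : EuclideanSpace ℝ (Fin N) →L[ℝ] ℝ)) x := by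
  induction P using MvPolynomial.induction_on with
  | C a => simpa using hasFDerivAt_const a x
  | add p q hp hq =>
    simp only [map_add, add_smul, Finset.sum_add_distrib]
    exact hp.add hq
  | mul_X p j hp =>
    have hX : HasFDerivAt (fun y : EuclideanSpace ℝ (Fin N) => y j)
        (EuclideanSpace.proj j : EuclideanSpace ℝ (Fin N) →L[ℝ] ℝ) x :=
      (EuclideanSpace.proj j : EuclideanSpace ℝ (Fin N) →L[ℝ] ℝ).hasFDerivAt
    simp only [map_mul, MvPolynomial.eval_X]
    refine (hp.mul hX).congr_fderiv ?_
    simp only [Derivation.leibniz, MvPolynomial.pderiv_X, smul_eq_mul, map_add, map_mul,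
      MvPolynomial.eval_X, add_smul, Finset.sum_add_distrib, Finset.smul_sum, mul_smul]
    congr 1
    rw [Finset.sum_eq_single j]
    · simp
    · intro i _ hij
      simp [hij.symm]
    · simp

theorem contDiff_eval_euclidean {N : ℕ} (P : MvPolynomial (Fin N) ℝ) {n : WithTop ℕ∞} :
    ContDiff ℝ n (fun y : EuclideanSpace ℝ (Fin N) => MvPolynomial.eval (fun i => y i) P) := by
  induction P using MvPolynomial.induction_on with
  | C a => simpa using contDiff_const
  | add p q hp hq => simpa using hp.add hq
  | mul_X p j hp =>
    have hX : ContDiff ℝ n (fun y : EuclideanSpace ℝ (Fin N) => y j) :=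
      (EuclideanSpace.proj j : EuclideanSpace ℝ (Fin N) →L[ℝ] ℝ).contDiff
    simpa using hp.mul hX

/-- An exponent m occurs in the i-th partial derivative only if m + e_i occurs in P, so the degree
drops by one. This drives the induction on ℓ in `integral_eval_mul_iteratedFDeriv_eq_zero`. -/
theorem sum_pderiv_mem_polynomialsDegreeLT {N ℓ : ℕ} {P : MvPolynomial (Fin N) ℝ}
    (hP : P ∈ polynomialsDegreeLT N (ℓ + 1)) (a : Fin N → ℝ) :
    ∑ i, MvPolynomial.C (a i) * MvPolynomial.pderiv i P ∈ polynomialsDegreeLT N ℓ := by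
  intro m hm
  obtain ⟨i, -, hi⟩ := Finset.exists_ne_zero_of_sum_ne_zero
    (f := fun i => (MvPolynomial.C (a i) * MvPolynomial.pderiv i P).coeff m)
    (s := Finset.univ) (by simpa [MvPolynomial.coeff_sum] using hm)
  rw [MvPolynomial.coeff_C_mul, MvPolynomial.coeff_pderiv] at hi
  have h := hP (m + Finsupp.single i 1)
    (MvPolynomial.mem_support_iff.2 (left_ne_zero_of_mul (right_ne_zero_of_mul hi)))
  simp only [map_add, Finsupp.degree_single] at h
  omega

theorem ContDiff.iteratedFDeriv_apply {E : Type*} [NormedAddCommGroup E] [NormedSpace ℝ E]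
    {φ : E → ℝ} (hφ : ContDiff ℝ ∞ φ) {j : ℕ} (v : Fin j → E) :
    ContDiff ℝ ∞ (fun x => iteratedFDeriv ℝ j φ x v) :=
  (ContinuousMultilinearMap.apply ℝ (fun _ : Fin j => E) ℝ v).contDiff.comp
    (hφ.iteratedFDeriv_right (by exact_mod_cast le_top))

theorem HasCompactSupport.iteratedFDeriv_apply {E : Type*} [NormedAddCommGroup E] [NormedSpace ℝ E]
    {φ : E → ℝ} (hφ : HasCompactSupport φ) {j : ℕ} (v : Fin j → E) :
    HasCompactSupport (fun x => _root_.iteratedFDeriv ℝ j φ x v) :=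
  (hφ.iteratedFDeriv (𝕜 := ℝ) j).comp_left
    (g := fun L : ContinuousMultilinearMap ℝ (fun _ : Fin j => E) ℝ => L v) rfl

theorem fderiv_iteratedFDeriv_apply {E : Type*} [NormedAddCommGroup E] [NormedSpace ℝ E]
    {φ : E → ℝ} (hφ : ContDiff ℝ ∞ φ) {j : ℕ} (v : Fin j → E) (x h : E) :
    fderiv ℝ (fun y => iteratedFDeriv ℝ j φ y v) x h =
      iteratedFDeriv ℝ (j + 1) φ x (Fin.cons h v) := by
  have hd : DifferentiableAt ℝ (iteratedFDeriv ℝ j φ) x :=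
    (hφ.differentiable_iteratedFDeriv (m := j) (by exact_mod_cast ENat.natCast_lt_top j)) x
  rw [iteratedFDeriv_succ_apply_left]
  have := ((ContinuousMultilinearMap.apply ℝ (fun _ : Fin j => E) ℝ v).hasFDerivAt.comp x
    hd.hasFDerivAt).fderiv
  simp only [Function.comp_def, ContinuousMultilinearMap.apply_apply] at this
  rw [this]
  simp

/-- Polynomials of degree less than `ℓ` are annihilated by `ℓ`-th order derivatives. -/
theorem integral_eval_mul_iteratedFDeriv_eq_zero {N ℓ : ℕ} {P : MvPolynomial (Fin N) ℝ}
    (hP : P ∈ polynomialsDegreeLT N ℓ) {φ : EuclideanSpace ℝ (Fin N) → ℝ} (hφ : ContDiff ℝ ∞ φ)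
    (hc : HasCompactSupport φ) (v : Fin ℓ → EuclideanSpace ℝ (Fin N)) :
    ∫ x : EuclideanSpace ℝ (Fin N), MvPolynomial.eval (fun i => x i) P *
      iteratedFDeriv ℝ ℓ φ x v = 0 := by
  induction ℓ generalizing P with
  | zero =>
    have : P = 0 := by
      rw [← MvPolynomial.support_eq_empty, Finset.eq_empty_iff_forall_notMem]
      intro m hm
      exact absurd (hP m hm) (by simp)
    simp [this]
  | succ ℓ ih =>
    -- The derivative in the direction `v 0` is moved onto the polynomial; the other ℓ stay on φ.
    have hs := fderiv_iteratedFDeriv_apply hφ (Fin.tail v) (h := v 0)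
    simp only [Fin.cons_self_tail] at hs
    simp_rw [← hs]
    have hφ' : ContDiff ℝ ∞ (fun x => iteratedFDeriv ℝ ℓ φ x (Fin.tail v)) :=
      hφ.iteratedFDeriv_apply _
    have hc' : HasCompactSupport (fun x => iteratedFDeriv ℝ ℓ φ x (Fin.tail v)) :=
      hc.iteratedFDeriv_apply _
    have hD : ∀ x, fderiv ℝ (fun y : EuclideanSpace ℝ (Fin N) =>
        MvPolynomial.eval (fun i => y i) P) x (v 0) = MvPolynomial.eval (fun i => x i)
          (∑ i, MvPolynomial.C (v 0 i) * MvPolynomial.pderiv i P) := by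
      intro x
      rw [(hasFDerivAt_eval_euclidean P x).fderiv]
      simp [mul_comm]
    have hPc := (contDiff_eval_euclidean (n := ∞) P)
    rw [integral_mul_fderiv_eq_neg_fderiv_mul_of_integrable]
    · simp_rw [hD]
      rw [ih (sum_pderiv_mem_polynomialsDegreeLT hP _), neg_zero]
    · simp_rw [hD]
      exact ((contDiff_eval_euclidean (n := ∞) _).continuous.mul
        hφ'.continuous).integrable_of_hasCompactSupport hc'.mul_left
    · refine (hPc.continuous.mul ?_).integrable_of_hasCompactSupport
        (hc'.fderiv_apply (𝕜 := ℝ) (v 0)).mul_left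
      exact (hφ'.continuous_fderiv (by simp)).clm_apply continuous_const
    · exact (hPc.continuous.mul hφ'.continuous).integrable_of_hasCompactSupport hc'.mul_left
    · exact fun x _ => (hPc.differentiable (by simp)) x
    · exact fun x _ => (hφ'.differentiable (by simp)) x

theorem iteratedFDeriv_comp_smul_sub {E : Type*} [NormedAddCommGroup E] [NormedSpace ℝ E]
    {φ : E → ℝ} (hφ : ContDiff ℝ ∞ φ) (j : ℕ) (a : ℝ) (c y : E) :
    iteratedFDeriv ℝ j (fun y => φ (a • (y - c))) y =
      a ^ j • iteratedFDeriv ℝ j φ (a • (y - c)) := by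
  have h := iteratedFDeriv_comp_const_smul (i := j) a (hφ.of_le (by exact_mod_cast le_top))
  have := iteratedFDeriv_comp_sub (𝕜 := ℝ) (f := fun z => φ (a • z)) j c y
  rw [this, h]

/-! ### Taylor expansion in one variable and reproducing weights. -/

/-- Taylor's formula of order `m + 1`, with the remainder controlled by the oscillation of the last
derivative. -/
theorem abs_taylor_remainder_le (m : ℕ) (A : ℕ → ℝ → ℝ)
    (hA : ∀ j ≤ m, ∀ s, HasDerivAt (A j) (A (j + 1) s) s) (hc : Continuous (A (m + 1)))
    {t : ℝ} (ht : 0 ≤ t) :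
    |A 0 t - ∑ j ∈ Finset.range (m + 2), t ^ j / j.factorial * A j 0| ≤
      t ^ m * ∫ s in (0 : ℝ)..t, |A (m + 1) s - A (m + 1) 0| := by
  induction m generalizing A t with
  | zero =>
    have h1 : ∫ s in (0 : ℝ)..t, (A 1 s - A 1 0) = A 0 t - A 0 0 - t * A 1 0 := by
      rw [intervalIntegral.integral_sub (hc.intervalIntegrable _ _)
        (continuous_const.intervalIntegrable _ _), intervalIntegral.integral_eq_sub_of_hasDerivAt
        (fun s _ => hA 0 le_rfl s) (hc.intervalIntegrable _ _)]
      simp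
    have h2 : A 0 t - ∑ j ∈ Finset.range (0 + 2), t ^ j / j.factorial * A j 0 =
        ∫ s in (0 : ℝ)..t, (A 1 s - A 1 0) := by
      rw [h1]; simp [Finset.sum_range_succ]; ring
    rw [h2, pow_zero, one_mul]
    exact intervalIntegral.abs_integral_le_integral_abs ht
  | succ m ih =>
    have ih' := fun (s : ℝ) (hs : 0 ≤ s) => ih (fun j => A (j + 1))
      (fun j hj s => hA (j + 1) (by omega) s) hc hs
    set I : ℝ := ∫ s in (0 : ℝ)..t, |A (m + 1 + 1) s - A (m + 1 + 1) 0| with hI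
    have hci : ∀ a b, IntervalIntegrable (fun s => |A (m + 1 + 1) s - A (m + 1 + 1) 0|) volume a b :=
      fun a b => (hc.sub continuous_const).abs.intervalIntegrable a b
    -- The derivative of the remainder is the remainder of one order less for the shifted family.
    -- The induction hypothesis bounds it by t^m I on [0, t], and the mean value inequality from f 0
    -- = 0 supplies the missing factor t.
    let f : ℝ → ℝ := fun s =>
      A 0 s - ∑ j ∈ Finset.range (m + 1 + 2), s ^ j / j.factorial * A j 0
    let f' : ℝ → ℝ := fun s =>
      A 1 s - ∑ j ∈ Finset.range (m + 2), s ^ j / j.factorial * A (j + 1) 0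
    have hf : ∀ s, HasDerivAt f (f' s) s := by
      intro s
      refine (hA 0 (by omega) s).sub ?_
      have : ∀ j ∈ Finset.range (m + 1 + 2), HasDerivAt
          (fun s : ℝ => s ^ j / j.factorial * A j 0) (j * s ^ (j - 1) / j.factorial * A j 0) s :=
        fun j _ => ((hasDerivAt_pow j s).div_const _).mul_const _
      refine (HasDerivAt.fun_sum this).congr_deriv ?_
      rw [Finset.sum_range_succ']
      simp only [Nat.cast_zero, zero_mul, zero_div, add_zero]
      refine Finset.sum_congr rfl fun j _ => ?_
      rw [Nat.factorial_succ]
      push_cast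
      field_simp
    have hbd : ∀ s ∈ Set.Ico 0 t, ‖f' s‖ ≤ t ^ m * I := by
      intro s hs
      refine (ih' s hs.1).trans (mul_le_mul (pow_le_pow_left₀ hs.1 hs.2.le m) ?_ ?_ (by positivity))
      · exact intervalIntegral.integral_mono_interval le_rfl hs.1 hs.2.le
          (Filter.Eventually.of_forall fun _ => abs_nonneg _) (hci _ _)
      · exact intervalIntegral.integral_nonneg hs.1 fun _ _ => abs_nonneg _
    have h0 : f 0 = 0 := by
      simp only [f]
      rw [Finset.sum_range_succ']
      simp
    have := norm_image_sub_le_of_norm_deriv_le_segment' (f := f) (f' := f')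
      (fun s _ => (hf s).hasDerivWithinAt) hbd t ⟨ht, le_rfl⟩
    rw [h0, sub_zero, sub_zero] at this
    calc _ = ‖f t‖ := rfl
      _ ≤ t ^ m * I * t := this
      _ = _ := by rw [pow_succ]; ring

/-- Weights reproducing the value at `0` of polynomials of degree less than `n` from
finitely many values in `(0, 1)`. -/
theorem exists_weights_reproducing (n : ℕ) :
    ∃ c τ : Fin n → ℝ, (∀ i, τ i ∈ Set.Ioo (0 : ℝ) 1) ∧
      ∀ j < n, ∑ i, c i * τ i ^ j = (0 : ℝ) ^ j := by
  -- Any n distinct points of (0, 1) would do. The weights are the Lagrange basis polynomials at 0,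
  -- because interpolation of X^j is exact for j < n.
  let τ : Fin n → ℝ := fun i => 1 / ((i : ℝ) + 2)
  have hinj : Set.InjOn τ (Finset.univ : Finset (Fin n)) := by
    intro a _ b _ h
    simp only [τ, one_div, inv_inj, add_left_inj, Nat.cast_inj] at h
    exact Fin.ext h
  refine ⟨fun i => (Lagrange.basis Finset.univ τ i).eval 0, τ, fun i => ⟨by positivity, ?_⟩, ?_⟩
  · have : (0 : ℝ) ≤ (i : ℕ) := Nat.cast_nonneg _
    simp only [τ]
    rw [div_lt_one (by linarith)]
    linarith
  · intro j hj
    have h := Lagrange.eq_interpolate (f := (Polynomial.X : Polynomial ℝ) ^ j) hinj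
      (by simpa using hj)
    have h2 := congrArg (Polynomial.eval 0) h
    simp only [Polynomial.eval_pow, Polynomial.eval_X, Lagrange.interpolate_apply,
      Polynomial.eval_finsetSum, Polynomial.eval_mul, Polynomial.eval_C] at h2
    rw [h2]
    exact Finset.sum_congr rfl fun i _ => mul_comm _ _

/-- The value at `0` of a function differs from a fixed combination of its values at the points
`τ i * r` by at most the oscillation of the derivative of order `m + 1`. -/
theorem abs_sub_sum_weights_le {m : ℕ} {c τ : Fin (m + 2) → ℝ}
    (hτ : ∀ i, τ i ∈ Set.Ioo (0 : ℝ) 1)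
    (hc : ∀ j < m + 2, ∑ i, c i * τ i ^ j = (0 : ℝ) ^ j) (A : ℕ → ℝ → ℝ)
    (hA : ∀ j ≤ m, ∀ s, HasDerivAt (A j) (A (j + 1) s) s) (hcont : Continuous (A (m + 1)))
    {r : ℝ} (hr : 0 ≤ r) :
    |A 0 0 - ∑ i, c i * A 0 (τ i * r)| ≤
      (∑ i, |c i|) * (r ^ m * ∫ s in (0 : ℝ)..r, |A (m + 1) s - A (m + 1) 0|) := by
  -- The weights cancel every Taylor term of degree 1 to m + 1 and keep the constant one.
  have h1 : A 0 0 = ∑ i, c i * ∑ j ∈ Finset.range (m + 2),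
      (τ i * r) ^ j / j.factorial * A j 0 := by
    simp_rw [Finset.mul_sum]
    rw [Finset.sum_comm]
    have : ∀ j ∈ Finset.range (m + 2), ∑ i, c i * ((τ i * r) ^ j / j.factorial * A j 0) =
        (0 : ℝ) ^ j * (r ^ j / j.factorial * A j 0) := by
      intro j hj
      rw [← hc j (Finset.mem_range.1 hj), Finset.sum_mul]
      refine Finset.sum_congr rfl fun i _ => ?_
      rw [mul_pow]; ring
    rw [Finset.sum_congr rfl this, Finset.sum_range_succ']
    simp
  conv_lhs => rw [h1]
  rw [← Finset.sum_sub_distrib, Finset.sum_mul]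
  refine (Finset.abs_sum_le_sum_abs _ _).trans (Finset.sum_le_sum fun i _ => ?_)
  rw [← mul_sub, abs_mul, abs_sub_comm]
  have h0 : 0 ≤ τ i * r := mul_nonneg (hτ i).1.le hr
  have hle : τ i * r ≤ r := mul_le_of_le_one_left hr (hτ i).2.le
  gcongr
  refine (abs_taylor_remainder_le m A hA hcont h0).trans ?_
  refine mul_le_mul (pow_le_pow_left₀ h0 hle m) ?_ ?_ (by positivity)
  · exact intervalIntegral.integral_mono_interval le_rfl h0 hle
      (Filter.Eventually.of_forall fun _ => abs_nonneg _)
      ((hcont.sub continuous_const).abs.intervalIntegrable _ _)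
  · exact intervalIntegral.integral_nonneg h0 fun _ _ => abs_nonneg _

/-! ### Averages against scaled bumps: the Campanato and Gagliardo bounds. -/

theorem lintegral_comp_add_smul {N : ℕ} {f : EuclideanSpace ℝ (Fin N) → ℝ≥0∞} (hf : Measurable f)
    (c : EuclideanSpace ℝ (Fin N)) {s : ℝ} (hs : 0 < s) :
    ∫⁻ h, f (c + s • h) = ENNReal.ofReal (s ^ N)⁻¹ * ∫⁻ y, f y := by
  have hm : Measurable fun h => f (c + h) := hf.comp (measurable_const_add c)
  rw [← lintegral_add_left_eq_self f c]
  have h1 := lintegral_map (μ := volume) hm (measurable_const_smul s)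
  rw [← h1, Measure.map_addHaar_smul volume hs.ne', lintegral_smul_measure, smul_eq_mul,
    finrank_euclideanSpace_fin, abs_of_pos (by positivity)]

theorem integral_comp_add_smul {N : ℕ} (f : EuclideanSpace ℝ (Fin N) → ℝ)
    (c : EuclideanSpace ℝ (Fin N)) {s : ℝ} (hs : 0 < s) :
    ∫ h, f (c + s • h) = (s ^ N)⁻¹ * ∫ y, f y := by
  rw [Measure.integral_comp_smul volume (fun h => f (c + h)) s, integral_add_left_eq_self f c,
    finrank_euclideanSpace_fin, abs_of_pos (by positivity), smul_eq_mul]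

theorem MeasureTheory.LocallyIntegrable.continuousMultilinearMap_apply {N j : ℕ}
    {g : EuclideanSpace ℝ (Fin N) →
      ContinuousMultilinearMap ℝ (fun _ : Fin j => EuclideanSpace ℝ (Fin N)) ℝ}
    (hg : LocallyIntegrable g volume) (v : Fin j → EuclideanSpace ℝ (Fin N)) :
    LocallyIntegrable (fun x => g x v) volume := fun x =>
  let ⟨U, hU, hi⟩ := hg x
  ⟨U, hU, (ContinuousMultilinearMap.apply ℝ
    (fun _ : Fin j => EuclideanSpace ℝ (Fin N)) ℝ v).integrable_comp hi⟩

/-- Pairing a weak derivative of order `ℓ` with a test function supported in a ball only sees the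
function modulo polynomials of degree less than `ℓ`. -/
theorem HasWeakDeriv.enorm_integral_mul_le {N ℓ : ℕ} {u : EuclideanSpace ℝ (Fin N) → ℝ}
    {g : EuclideanSpace ℝ (Fin N) →
      ContinuousMultilinearMap ℝ (fun _ : Fin ℓ => EuclideanSpace ℝ (Fin N)) ℝ}
    (hg : HasWeakDeriv ℓ u g) {φ : EuclideanSpace ℝ (Fin N) → ℝ} (hφ : ContDiff ℝ ∞ φ)
    (hc : HasCompactSupport φ) {s : Set (EuclideanSpace ℝ (Fin N))} (hs : MeasurableSet s)
    (hsupp : tsupport φ ⊆ s) (v : Fin ℓ → EuclideanSpace ℝ (Fin N)) {B : ℝ}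
    (hB : ∀ y, |iteratedFDeriv ℝ ℓ φ y v| ≤ B) {P : MvPolynomial (Fin N) ℝ}
    (hP : P ∈ polynomialsDegreeLT N ℓ) :
    ‖∫ x, φ x * g x v‖ₑ ≤
      ENNReal.ofReal B * ∫⁻ y in s, ‖u y - MvPolynomial.eval (fun i => y i) P‖ₑ := by
  have hφ' := hφ.iteratedFDeriv_apply v
  have hc' := hc.iteratedFDeriv_apply v
  have h1 : Integrable fun x => u x * iteratedFDeriv ℝ ℓ φ x v := by
    simpa [mul_comm] using hg.1.integrable_smul_left_of_hasCompactSupport hφ'.continuous hc'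
  have h2 : Integrable fun x : EuclideanSpace ℝ (Fin N) =>
      MvPolynomial.eval (fun i => x i) P * iteratedFDeriv ℝ ℓ φ x v :=
    ((contDiff_eval_euclidean (n := ∞) P).continuous.mul
      hφ'.continuous).integrable_of_hasCompactSupport hc'.mul_left
  have h3 : ∫ x, (u x - MvPolynomial.eval (fun i => x i) P) * iteratedFDeriv ℝ ℓ φ x v =
      (-1) ^ ℓ * ∫ x, φ x * g x v := by
    simp_rw [sub_mul]
    rw [integral_sub h1 h2, integral_eval_mul_iteratedFDeriv_eq_zero hP hφ hc, sub_zero,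
      hg.2.2 φ hφ hc v]
  have h4 : ‖∫ x, φ x * g x v‖ₑ =
      ‖∫ x, (u x - MvPolynomial.eval (fun i => x i) P) * iteratedFDeriv ℝ ℓ φ x v‖ₑ := by
    rw [h3, enorm_mul, enorm_pow]
    simp
  rw [h4]
  refine (enorm_integral_le_lintegral_enorm _).trans ?_
  rw [← lintegral_const_mul' _ _ ENNReal.ofReal_ne_top, ← lintegral_indicator hs]
  refine lintegral_mono fun x => ?_
  by_cases hx : x ∈ s
  · rw [Set.indicator_of_mem hx, enorm_mul, mul_comm]
    gcongr
    rw [Real.enorm_eq_ofReal_abs]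
    exact ENNReal.ofReal_le_ofReal (hB x)
  · have : iteratedFDeriv ℝ ℓ φ x = 0 := by
      by_contra h
      exact hx (hsupp (support_iteratedFDeriv_subset (𝕜 := ℝ) ℓ h))
    simp [this]

/-- Averages of `D^ℓ u` against a scaled bump function are controlled by the Campanato seminorm. -/
theorem exists_enorm_integral_bump_mul_le_campanatoSeminorm {N : ℕ} (ℓ : ℕ)
    {η : EuclideanSpace ℝ (Fin N) → ℝ} (hη : ContDiff ℝ ∞ η) (hc : HasCompactSupport η)
    (hsupp : tsupport η ⊆ Metric.ball 0 1) :
    ∃ K : ℝ≥0, ∀ (u : EuclideanSpace ℝ (Fin N) → ℝ) (g : EuclideanSpace ℝ (Fin N) →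
      ContinuousMultilinearMap ℝ (fun _ : Fin ℓ => EuclideanSpace ℝ (Fin N)) ℝ),
      HasWeakDeriv ℓ u g → ∀ (lam ρ t : ℝ), 0 < t → t < ρ →
      ∀ (c : EuclideanSpace ℝ (Fin N)) (v : Fin ℓ → EuclideanSpace ℝ (Fin N)),
        ‖∫ h, η h * g (c + t • h) v‖ₑ ≤ K * ENNReal.ofReal (∏ i, ‖v i‖) *
          (ENNReal.ofReal (t ^ (-(ℓ : ℝ) - lam)) * campanatoSeminorm lam ℓ ρ u) := by
  obtain ⟨S, hS⟩ := (hc.iteratedFDeriv (𝕜 := ℝ) ℓ).exists_bound_of_continuous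
    (hη.continuous_iteratedFDeriv (m := ℓ) (by exact_mod_cast le_top))
  have hS0 : 0 ≤ S := (norm_nonneg _).trans (hS 0)
  have hfin : volume (Metric.ball (0 : EuclideanSpace ℝ (Fin N)) 1) ≠ ⊤ := measure_ball_lt_top.ne
  -- The supremum of D^ℓ η times the volume of the unit ball. Rescaling η by t costs t^(-ℓ), and the
  -- Jacobian t^(-N) cancels the volume factor of the ball of radius t.
  refine ⟨S.toNNReal * (volume (Metric.ball (0 : EuclideanSpace ℝ (Fin N)) 1)).toNNReal, ?_⟩
  intro u g hg lam ρ t ht htρ c v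
  set V : ℝ := ∏ i, ‖v i‖ with hV
  have hV0 : 0 ≤ V := Finset.prod_nonneg fun _ _ => norm_nonneg _
  set φ : EuclideanSpace ℝ (Fin N) → ℝ := fun y => η (t⁻¹ • (y - c)) with hφdef
  have hφ : ContDiff ℝ ∞ φ := hη.comp ((contDiff_id.sub contDiff_const).const_smul t⁻¹)
  have hts : tsupport φ ⊆ (fun y => t⁻¹ • (y - c)) ⁻¹' tsupport η :=
    tsupport_comp_subset_preimage η (f := fun y => t⁻¹ • (y - c)) (by fun_prop)
  have htsupp : tsupport φ ⊆ Metric.ball c t := by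
    intro y hy
    have := hsupp (hts hy)
    rw [mem_ball_zero_iff, norm_smul, norm_inv, Real.norm_of_nonneg ht.le,
      inv_mul_lt_iff₀ ht, mul_one] at this
    rwa [mem_ball_iff_norm]
  have hφc : HasCompactSupport φ :=
    (isCompact_closedBall c t).of_isClosed_subset (isClosed_tsupport _)
      (htsupp.trans Metric.ball_subset_closedBall)
  have hint : ∫ h, η h * g (c + t • h) v = (t ^ N)⁻¹ * ∫ y, φ y * g y v := by
    rw [← integral_comp_add_smul (fun y => φ y * g y v) c ht]
    simp [hφdef, smul_smul, inv_mul_cancel₀ ht.ne']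
  have hB : ∀ y, |iteratedFDeriv ℝ ℓ φ y v| ≤ (t⁻¹) ^ ℓ * (S * V) := by
    intro y
    rw [iteratedFDeriv_comp_smul_sub hη, smul_apply, smul_eq_mul, abs_mul,
      abs_of_nonneg (by positivity)]
    gcongr
    exact ((iteratedFDeriv ℝ ℓ η (t⁻¹ • (y - c))).le_opNorm v).trans
      (mul_le_mul_of_nonneg_right (hS _) hV0)
  set a : ℝ≥0∞ := (S.toNNReal * (volume (Metric.ball (0 : EuclideanSpace ℝ (Fin N)) 1)).toNNReal :
    ℝ≥0) * ENNReal.ofReal V * ENNReal.ofReal (t ^ (-(ℓ : ℝ))) with ha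
  have hatop : a ≠ ⊤ := by
    rw [ha]
    exact ENNReal.mul_ne_top (ENNReal.mul_ne_top ENNReal.coe_ne_top ENNReal.ofReal_ne_top)
      ENNReal.ofReal_ne_top
  set X : ℝ≥0∞ := ‖∫ h, η h * g (c + t • h) v‖ₑ with hX
  have hkey : ∀ P ∈ polynomialsDegreeLT N ℓ, X ≤ a *
      ⨍⁻ y in Metric.ball c t, ‖u y - MvPolynomial.eval (fun i => y i) P‖ₑ ∂volume := by
    intro P hP
    rw [hX, hint, enorm_mul]
    refine (mul_le_mul_right (hg.enorm_integral_mul_le hφ hφc measurableSet_ball htsupp v hB hP)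
      _).trans (le_of_eq ?_)
    have hvol : volume (Metric.ball c t) =
        ENNReal.ofReal (t ^ N) * volume (Metric.ball (0 : EuclideanSpace ℝ (Fin N)) 1) := by
      rw [Measure.addHaar_ball_of_pos _ _ ht, finrank_euclideanSpace_fin]
    rw [← measure_mul_setLAverage (s := Metric.ball c t) _ measure_ball_lt_top.ne, hvol, ha,
      Real.enorm_of_nonneg (by positivity), ENNReal.ofReal_inv_of_pos (by positivity),
      ENNReal.coe_mul, ENNReal.coe_toNNReal hfin, Real.rpow_neg ht.le, Real.rpow_natCast,
      ← inv_pow, ENNReal.ofReal_mul (by positivity), ENNReal.ofReal_mul hS0]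
    have hT : (ENNReal.ofReal (t ^ N))⁻¹ * ENNReal.ofReal (t ^ N) = 1 :=
      ENNReal.inv_mul_cancel (by simpa using pow_pos ht N) ENNReal.ofReal_ne_top
    rw [show ((S.toNNReal : ℝ≥0) : ℝ≥0∞) = ENNReal.ofReal S from rfl]
    generalize (⨍⁻ y in Metric.ball c t, ‖u y - MvPolynomial.eval (fun i => y i) P‖ₑ ∂volume) = A
    calc _ = ((ENNReal.ofReal (t ^ N))⁻¹ * ENNReal.ofReal (t ^ N)) *
          (ENNReal.ofReal S * volume (Metric.ball (0 : EuclideanSpace ℝ (Fin N)) 1) *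
            ENNReal.ofReal V * ENNReal.ofReal (t⁻¹ ^ ℓ) * A) := by ring
      _ = _ := by rw [hT, one_mul]
  set J : ℝ≥0∞ := ⨅ P ∈ polynomialsDegreeLT N ℓ,
    ⨍⁻ y in Metric.ball c t, ‖u y - MvPolynomial.eval (fun i => y i) P‖ₑ ∂volume with hJ
  -- Passing to the infimum over P needs division by `a`, hence the separate case a = 0.
  have hXJ : X ≤ a * J := by
    rcases eq_or_ne a 0 with h0 | h0
    · have := hkey 0 (by simp [polynomialsDegreeLT])
      rw [h0, zero_mul] at this
      exact this.trans zero_le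
    · rw [← ENNReal.div_le_iff' h0 hatop]
      exact le_iInf₂ fun P hP => (ENNReal.div_le_iff' h0 hatop).2 (hkey P hP)
  have hJM : ENNReal.ofReal (t ^ lam) * J ≤ campanatoSeminorm lam ℓ ρ u :=
    (le_iSup₂ (f := fun (r : ℝ) (_ : r ∈ Set.Ioo 0 ρ) => ENNReal.ofReal (r ^ lam) *
      ⨅ P ∈ polynomialsDegreeLT N ℓ,
        ⨍⁻ y in Metric.ball c r, ‖u y - MvPolynomial.eval (fun i => y i) P‖ₑ ∂volume)
      t ⟨ht, htρ⟩).trans (le_iSup (fun x => ⨆ r ∈ Set.Ioo 0 ρ, ENNReal.ofReal (r ^ lam) *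
      ⨅ P ∈ polynomialsDegreeLT N ℓ,
        ⨍⁻ y in Metric.ball x r, ‖u y - MvPolynomial.eval (fun i => y i) P‖ₑ ∂volume) c)
  refine hXJ.trans ?_
  have hsplit : ENNReal.ofReal (t ^ (-(ℓ : ℝ))) =
      ENNReal.ofReal (t ^ (-(ℓ : ℝ) - lam)) * ENNReal.ofReal (t ^ lam) := by
    rw [← ENNReal.ofReal_mul (by positivity), ← Real.rpow_add ht, sub_add_cancel]
  rw [ha, hsplit]
  calc _ = ((S.toNNReal * (volume (Metric.ball (0 : EuclideanSpace ℝ (Fin N)) 1)).toNNReal :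
    ℝ≥0) : ℝ≥0∞) * ENNReal.ofReal V *
      (ENNReal.ofReal (t ^ (-(ℓ : ℝ) - lam)) * (ENNReal.ofReal (t ^ lam) * J)) := by ring
    _ ≤ _ := by gcongr

/-- The local Gagliardo energy of `F` at the point `x`, raised to the power `1 / p`. -/
noncomputable def localGagliardo {N : ℕ} {G : Type*} [NormedAddCommGroup G] (σ p : ℝ)
    (F : EuclideanSpace ℝ (Fin N) → G) (x : EuclideanSpace ℝ (Fin N)) : ℝ≥0∞ :=
  (∫⁻ y, ‖F x - F y‖ₑ ^ p / ‖x - y‖ₑ ^ ((N : ℝ) + σ * p)) ^ (1 / p)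

/-- The mean oscillation of `F` at `c` on the scale `s` is at most a constant times `s ^ σ` times
the local Gagliardo energy. -/
theorem exists_lintegral_bump_mul_le_localGagliardo {N : ℕ} {G : Type*} [NormedAddCommGroup G]
    {σ p : ℝ} (hp : 1 ≤ p) (hσ : 0 < σ) {η : EuclideanSpace ℝ (Fin N) → ℝ} (hη : Continuous η)
    (hc : HasCompactSupport η) (hsupp : tsupport η ⊆ Metric.ball 0 1) :
    ∃ K : ℝ≥0, ∀ F : EuclideanSpace ℝ (Fin N) → G, StronglyMeasurable F →
      ∀ (c : EuclideanSpace ℝ (Fin N)) (s : ℝ), 0 < s →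
        ∫⁻ h, ‖η h‖ₑ * ‖F (c + s • h) - F c‖ₑ ≤
          K * ENNReal.ofReal (s ^ σ) * localGagliardo σ p F c := by
  obtain ⟨S, hS⟩ := hc.exists_bound_of_continuous hη
  have hp0 : 0 < p := by linarith
  set κ := volume (Metric.ball (0 : EuclideanSpace ℝ (Fin N)) 1) with hκ
  have hfin : κ ≠ ⊤ := measure_ball_lt_top.ne
  have hfin' : κ ^ (1 / (1 : ℝ) - 1 / p) ≠ ⊤ :=
    ENNReal.rpow_ne_top_of_nonneg (by
      rw [sub_nonneg]; exact one_div_le_one_div_of_le one_pos hp) hfin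
  refine ⟨S.toNNReal * (κ ^ (1 / (1 : ℝ) - 1 / p)).toNNReal, fun F hF c s hs => ?_⟩
  set f : EuclideanSpace ℝ (Fin N) → G := fun h => F (c + s • h) - F c with hf
  have hfm : StronglyMeasurable f :=
    (hF.comp_measurable (by fun_prop)).sub stronglyMeasurable_const
  have h1 : ∫⁻ h, ‖η h‖ₑ * ‖f h‖ₑ ≤ ENNReal.ofReal S * ∫⁻ h in Metric.ball 0 1, ‖f h‖ₑ := by
    rw [← lintegral_const_mul' _ _ ENNReal.ofReal_ne_top, ← lintegral_indicator measurableSet_ball]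
    refine lintegral_mono fun h => ?_
    by_cases hx : h ∈ Metric.ball (0 : EuclideanSpace ℝ (Fin N)) 1
    · rw [Set.indicator_of_mem hx]
      gcongr
      rw [← ofReal_norm]
      exact ENNReal.ofReal_le_ofReal (hS h)
    · have : η h = 0 := image_eq_zero_of_notMem_tsupport fun h' => hx (hsupp h')
      simp [this]
  -- Hölder's inequality from L^1 to L^p on the unit ball.
  have h2 : ∫⁻ h in Metric.ball 0 1, ‖f h‖ₑ ≤
      (∫⁻ h in Metric.ball 0 1, ‖f h‖ₑ ^ p) ^ (1 / p) * κ ^ (1 / (1 : ℝ) - 1 / p) := by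
    have := eLpNorm'_le_eLpNorm'_mul_rpow_measure_univ
      (μ := volume.restrict (Metric.ball (0 : EuclideanSpace ℝ (Fin N)) 1)) one_pos hp
      hfm.aestronglyMeasurable
    simpa [eLpNorm'] using this
  set Φ : EuclideanSpace ℝ (Fin N) → ℝ≥0∞ :=
    fun y => ‖F c - F y‖ₑ ^ p / ‖c - y‖ₑ ^ ((N : ℝ) + σ * p) with hΦ
  have hΦm : Measurable Φ := by
    have h1 : Measurable fun y => ‖F c - F y‖ₑ := (stronglyMeasurable_const.sub hF).enorm
    have h2 : Measurable fun y => ‖c - y‖ₑ := by fun_prop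
    exact (h1.pow_const _).div (h2.pow_const _)
  have hexp : 0 < (N : ℝ) + σ * p := by positivity
  -- On the unit ball |s h| ≤ s, so the Gagliardo weight is at least s^(-(N+σp)). The change of
  -- variables then contributes s^(-N), which leaves s^(σp). Where f h ≠ 0 also h ≠ 0, so the
  -- denominator does not vanish.
  have h3 : ∫⁻ h in Metric.ball 0 1, ‖f h‖ₑ ^ p ≤
      ENNReal.ofReal (s ^ ((N : ℝ) + σ * p)) * ∫⁻ h, Φ (c + s • h) := by
    rw [← lintegral_const_mul' _ _ ENNReal.ofReal_ne_top, ← lintegral_indicator measurableSet_ball]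
    refine lintegral_mono fun h => ?_
    by_cases hx : h ∈ Metric.ball (0 : EuclideanSpace ℝ (Fin N)) 1
    · rw [Set.indicator_of_mem hx]
      rcases eq_or_ne (f h) 0 with h0 | h0
      · simp [h0, hp0]
      have hh : h ≠ 0 := by
        rintro rfl
        exact h0 (by simp [hf])
      have hb0 : ‖c - (c + s • h)‖ₑ ^ ((N : ℝ) + σ * p) ≠ 0 := by
        have : ‖c - (c + s • h)‖ₑ ≠ 0 := by simp [hs.ne', hh]
        exact (ENNReal.rpow_pos (pos_iff_ne_zero.2 this) enorm_ne_top).ne'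
      have hbt : ‖c - (c + s • h)‖ₑ ^ ((N : ℝ) + σ * p) ≠ ⊤ :=
        ENNReal.rpow_ne_top_of_nonneg hexp.le enorm_ne_top
      have hle : ‖c - (c + s • h)‖ₑ ^ ((N : ℝ) + σ * p) ≤ ENNReal.ofReal (s ^ ((N : ℝ) + σ * p)) := by
        rw [← ENNReal.ofReal_rpow_of_pos hs]
        gcongr
        rw [← ofReal_norm]
        apply ENNReal.ofReal_le_ofReal
        rw [sub_add_cancel_left, norm_neg, norm_smul, Real.norm_of_nonneg hs.le]
        exact mul_le_of_le_one_right hs.le (mem_ball_zero_iff.1 hx).le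
      calc ‖f h‖ₑ ^ p = ‖c - (c + s • h)‖ₑ ^ ((N : ℝ) + σ * p) * Φ (c + s • h) := by
            simp only [hΦ, hf]
            rw [ENNReal.mul_div_cancel hb0 hbt, ← enorm_neg, neg_sub]
        _ ≤ _ := by gcongr
    · simp [hx]
  have h4 : ∫⁻ h in Metric.ball 0 1, ‖f h‖ₑ ^ p ≤ ENNReal.ofReal (s ^ σ) ^ p * ∫⁻ y, Φ y := by
    refine h3.trans (le_of_eq ?_)
    rw [lintegral_comp_add_smul hΦm c hs, ← mul_assoc, ← ENNReal.ofReal_mul (by positivity),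
      ENNReal.ofReal_rpow_of_pos (by positivity), ← Real.rpow_mul hs.le, Real.rpow_add hs,
      Real.rpow_natCast, mul_comm (s ^ N), mul_assoc, mul_inv_cancel₀ (by positivity), mul_one]
  have h5 : (∫⁻ h in Metric.ball 0 1, ‖f h‖ₑ ^ p) ^ (1 / p) ≤
      ENNReal.ofReal (s ^ σ) * localGagliardo σ p F c := by
    refine (ENNReal.rpow_le_rpow h4 (by positivity)).trans (le_of_eq ?_)
    rw [ENNReal.mul_rpow_of_nonneg _ _ (by positivity), ← ENNReal.rpow_mul, mul_one_div_cancel hp0.ne',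
      ENNReal.rpow_one, localGagliardo]
  calc _ ≤ ENNReal.ofReal S * (ENNReal.ofReal (s ^ σ) * localGagliardo σ p F c *
        κ ^ (1 / (1 : ℝ) - 1 / p)) := h1.trans (by gcongr; exact h2.trans (by gcongr))
    _ = _ := by
      rw [ENNReal.coe_mul, ENNReal.coe_toNNReal hfin',
        show ((S.toNNReal : ℝ≥0) : ℝ≥0∞) = ENNReal.ofReal S from rfl]
      ring

/-! ### Mollifications and their expansion along rays. -/

/-- All derivatives fall on ψ, so local integrability of u suffices and no weak derivative of
intermediate order enters the Taylor expansion. -/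
theorem hasDerivAt_integral_mul_iteratedFDeriv {N j : ℕ} {u ψ : EuclideanSpace ℝ (Fin N) → ℝ}
    (hu : LocallyIntegrable u volume) (hψ : ContDiff ℝ ∞ ψ) (hc : HasCompactSupport ψ)
    (x h : EuclideanSpace ℝ (Fin N)) (w : Fin j → EuclideanSpace ℝ (Fin N)) (s : ℝ) :
    HasDerivAt (fun s : ℝ => ∫ y, u y * iteratedFDeriv ℝ j ψ (x + s • h - y) w)
      (∫ y, u y * iteratedFDeriv ℝ (j + 1) ψ (x + s • h - y) (Fin.cons h w)) s := by
  have hψ' := hψ.iteratedFDeriv_apply w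
  have hc' := hc.iteratedFDeriv_apply w
  have H := hc'.hasFDerivAt_convolution_right (ContinuousLinearMap.mul ℝ ℝ) hu
    (hψ'.of_le (by simp)) (x + s • h)
  have hl : HasDerivAt (fun s : ℝ => x + s • h) h s := by
    simpa using ((hasDerivAt_id s).smul_const h).const_add x
  have := H.comp_hasDerivAt s hl
  rw [convolution_precompR_apply _ hu (hc'.fderiv (𝕜 := ℝ))
    (hψ'.continuous_fderiv (by simp))] at this
  simpa [Function.comp_def, convolution_def, fderiv_iteratedFDeriv_apply hψ] using this

theorem continuous_integral_mul_comp_sub {N : ℕ} {u ψ : EuclideanSpace ℝ (Fin N) → ℝ}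
    (hu : LocallyIntegrable u volume) (hψ : Continuous ψ) (hc : HasCompactSupport ψ) :
    Continuous fun x => ∫ y, ψ (x - y) * u y := by
  have := hc.continuous_convolution_right (ContinuousLinearMap.mul ℝ ℝ) hu hψ
  refine this.congr fun x => ?_
  simp [convolution_def, mul_comm]

/-- Derivatives of a mollification are mollifications of weak derivatives. -/
theorem HasWeakDeriv.integral_mul_iteratedFDeriv_eq {N j : ℕ} {u : EuclideanSpace ℝ (Fin N) → ℝ}
    {g : EuclideanSpace ℝ (Fin N) →
      ContinuousMultilinearMap ℝ (fun _ : Fin j => EuclideanSpace ℝ (Fin N)) ℝ}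
    (hg : HasWeakDeriv j u g) {ψ : EuclideanSpace ℝ (Fin N) → ℝ}
    (hψ : ContDiff ℝ ∞ ψ) (hc : HasCompactSupport ψ)
    (x : EuclideanSpace ℝ (Fin N)) (w : Fin j → EuclideanSpace ℝ (Fin N)) :
    ∫ y, u y * iteratedFDeriv ℝ j ψ (x - y) w = ∫ y, ψ (x - y) * g y w := by
  -- Writing ψ(x - y) as a dilation by -1 makes its j-th derivative carry the sign (-1)^j, which
  -- cancels the sign in the definition of the weak derivative.
  have hφ : ContDiff ℝ ∞ (fun y => ψ ((-1 : ℝ) • (y - x))) :=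
    hψ.comp ((contDiff_id.sub contDiff_const).const_smul (-1 : ℝ))
  have hφc : HasCompactSupport (fun y => ψ ((-1 : ℝ) • (y - x))) := by
    have := hc.comp_homeomorph (Homeomorph.subLeft x)
    simpa [Function.comp_def, Homeomorph.subLeft] using this
  have h := hg.2.2 _ hφ hφc w
  simp_rw [iteratedFDeriv_comp_smul_sub hψ] at h
  have hsgn : ((-1 : ℝ) ^ j) * (-1) ^ j = 1 := by rw [← mul_pow]; simp
  calc ∫ y, u y * iteratedFDeriv ℝ j ψ (x - y) w
      = (-1) ^ j * ∫ y, u y * (((-1 : ℝ) ^ j • iteratedFDeriv ℝ j ψ ((-1 : ℝ) • (y - x))) w) := by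
        rw [← integral_const_mul]
        refine integral_congr_ae (Filter.Eventually.of_forall fun y => ?_)
        simp only [smul_apply, smul_eq_mul, neg_smul, one_smul, neg_sub]
        rw [mul_left_comm, ← mul_assoc ((-1 : ℝ) ^ j), hsgn, one_mul]
    _ = ∫ y, ψ ((-1 : ℝ) • (y - x)) * g y w := by rw [h, ← mul_assoc, hsgn, one_mul]
    _ = _ := by simp

/-- The family `(h, …, h, v₁, …, v_ℓ)` with `m` leading copies of `h`. -/
def prependCopies {E : Type*} {ℓ : ℕ} (h : E) (v : Fin ℓ → E) : ∀ m : ℕ, Fin (ℓ + m) → E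
  | 0 => v
  | m + 1 => Fin.cons h (prependCopies h v m)

theorem prod_norm_prependCopies {E : Type*} [NormedAddCommGroup E] {ℓ : ℕ} (h : E) (v : Fin ℓ → E)
    (m : ℕ) : ∏ i, ‖prependCopies h v m i‖ = ‖h‖ ^ m * ∏ i, ‖v i‖ := by
  induction m with
  | zero => simp [prependCopies]
  | succ m ih =>
    have : ∏ i : Fin (ℓ + m + 1), ‖(Fin.cons h (prependCopies h v m) : Fin (ℓ + m + 1) → E) i‖ =
        ‖h‖ * ∏ i, ‖prependCopies h v m i‖ := by simp [Fin.prod_univ_succ]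
    rw [pow_succ', mul_assoc, ← ih]
    exact this

/-- The hypothesis of Fubini's theorem for the swap below. The supports of η and ψ see G only on the
compact set `K`; there G is integrable, and by translation invariance the inner integral of its norm
does not depend on h. -/
theorem integrable_prod_mul_mul_comp_affine {N : ℕ} {η ψ G : EuclideanSpace ℝ (Fin N) → ℝ}
    (hη : Continuous η) (hηc : HasCompactSupport η) (hψ : Continuous ψ) (hψc : HasCompactSupport ψ)
    (hG : LocallyIntegrable G volume) (hGm : StronglyMeasurable G)
    (x : EuclideanSpace ℝ (Fin N)) (t : ℝ) :
    Integrable (fun q : EuclideanSpace ℝ (Fin N) × EuclideanSpace ℝ (Fin N) =>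
      η q.1 * (ψ q.2 * G (x + t • q.1 - q.2))) (volume.prod volume) := by
  obtain ⟨S, hS⟩ := hψc.exists_bound_of_continuous hψ
  set K : Set (EuclideanSpace ℝ (Fin N)) :=
    (fun q : EuclideanSpace ℝ (Fin N) × EuclideanSpace ℝ (Fin N) => x + t • q.1 - q.2) ''
      (tsupport η ×ˢ tsupport ψ) with hK
  have hKc : IsCompact K := (hηc.prod hψc).image (by fun_prop)
  have hI : Integrable (K.indicator G) :=
    (hG.integrableOn_isCompact hKc).integrable_indicator hKc.measurableSet
  have hbd : Integrable (fun q : EuclideanSpace ℝ (Fin N) × EuclideanSpace ℝ (Fin N) =>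
      η q.1 * (S * K.indicator G (x + t • q.1 - q.2))) (volume.prod volume) := by
    have hm : StronglyMeasurable (fun q : EuclideanSpace ℝ (Fin N) × EuclideanSpace ℝ (Fin N) =>
        η q.1 * (S * K.indicator G (x + t • q.1 - q.2))) :=
      (hη.comp continuous_fst).stronglyMeasurable.mul (stronglyMeasurable_const.mul
        ((hGm.indicator hKc.measurableSet).comp_measurable (by fun_prop)))
    rw [integrable_prod_iff hm.aestronglyMeasurable]
    refine ⟨Filter.Eventually.of_forall fun h =>
      ((hI.comp_sub_left (x + t • h)).const_mul S).const_mul (η h), ?_⟩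
    have : ∀ h : EuclideanSpace ℝ (Fin N),
        ∫ z, ‖η h * (S * K.indicator G (x + t • h - z))‖ = ‖η h‖ * (‖S‖ * ∫ z, ‖K.indicator G z‖) := by
      intro h
      simp_rw [norm_mul]
      rw [integral_const_mul, integral_const_mul,
        integral_sub_left_eq_self (fun z => ‖K.indicator G z‖) volume (x + t • h)]
    simp_rw [this]
    exact (hη.integrable_of_hasCompactSupport hηc).norm.mul_const _
  refine hbd.mono ?_ (Filter.Eventually.of_forall fun q => ?_)
  · exact ((hη.comp continuous_fst).stronglyMeasurable.mul
      ((hψ.comp continuous_snd).stronglyMeasurable.mul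
        (hGm.comp_measurable (by fun_prop)))).aestronglyMeasurable
  · rw [norm_mul, norm_mul, norm_mul, norm_mul]
    by_cases h1 : q.1 ∈ tsupport η
    · by_cases h2 : q.2 ∈ tsupport ψ
      · have : x + t • q.1 - q.2 ∈ K := ⟨q, ⟨h1, h2⟩, rfl⟩
        rw [Set.indicator_of_mem this]
        gcongr
        exact (hS _).trans (le_abs_self S)
      · simp only [image_eq_zero_of_notMem_tsupport h2, norm_zero, zero_mul, mul_zero]
        positivity
    · simp [image_eq_zero_of_notMem_tsupport h1]

/-- The bump average of a mollification is the mollification of the bump averages. A bound on these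
averages uniform in the centre therefore survives mollification when ψ has unit mass. -/
theorem integral_bump_mul_mollified_swap {N : ℕ} {η ψ G : EuclideanSpace ℝ (Fin N) → ℝ}
    (hη : Continuous η) (hηc : HasCompactSupport η) (hψ : Continuous ψ) (hψc : HasCompactSupport ψ)
    (hG : LocallyIntegrable G volume) (hGm : StronglyMeasurable G)
    (x : EuclideanSpace ℝ (Fin N)) (t : ℝ) :
    ∫ h, η h * ∫ y, ψ (x + t • h - y) * G y = ∫ z, ψ z * ∫ h, η h * G (x - z + t • h) := by
  have h1 : ∀ h, ∫ y, ψ (x + t • h - y) * G y = ∫ z, ψ z * G (x + t • h - z) := by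
    intro h
    rw [← integral_sub_left_eq_self _ volume (x + t • h)]
    simp
  simp_rw [h1, ← integral_const_mul]
  rw [integral_integral_swap
    (integrable_prod_mul_mul_comp_affine hη hηc hψ hψc hG hGm x t)]
  refine integral_congr_ae (Filter.Eventually.of_forall fun z =>
    integral_congr_ae (Filter.Eventually.of_forall fun h => ?_))
  have : x + t • h - z = x - z + t • h := by abel
  simp only [this]
  ring

/-- The increment of a mollified multilinear field is controlled by the mollified increments. -/
theorem enorm_integral_mul_apply_sub_le {N k : ℕ} {G : EuclideanSpace ℝ (Fin N) →
      ContinuousMultilinearMap ℝ (fun _ : Fin k => EuclideanSpace ℝ (Fin N)) ℝ}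
    (hG : LocallyIntegrable G volume) {ψ : EuclideanSpace ℝ (Fin N) → ℝ}
    (hψ : Continuous ψ) (hψc : HasCompactSupport ψ) (x a : EuclideanSpace ℝ (Fin N))
    (w : Fin k → EuclideanSpace ℝ (Fin N)) {V : ℝ} (hV : ∏ i, ‖w i‖ ≤ V) :
    ‖(∫ y, ψ (x + a - y) * G y w) - ∫ y, ψ (x - y) * G y w‖ₑ ≤
      ENNReal.ofReal V * ∫⁻ z, ‖ψ z‖ₑ * ‖G (x - z + a) - G (x - z)‖ₑ := by
  have hint : ∀ b, Integrable fun y => ψ (b - y) * G y w := by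
    intro b
    have := (hG.continuousMultilinearMap_apply w).integrable_smul_left_of_hasCompactSupport
      (g := fun y => ψ (b - y)) (by fun_prop) (hψc.comp_homeomorph (Homeomorph.subLeft b))
    simpa using this
  have h1 : ∀ b, ∫ y, ψ (b - y) * G y w = ∫ z, ψ z * G (b - z) w := by
    intro b
    rw [← integral_sub_left_eq_self _ volume b]
    simp
  have h2 : ∀ b, Integrable fun z => ψ z * G (b - z) w := by
    intro b
    simpa using (hint b).comp_sub_left b
  rw [h1, h1, ← integral_sub (h2 _) (h2 _)]
  refine (enorm_integral_le_lintegral_enorm _).trans ?_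
  rw [← lintegral_const_mul' _ _ ENNReal.ofReal_ne_top]
  refine lintegral_mono fun z => ?_
  have hz : x + a - z = x - z + a := by abel
  rw [hz, ← mul_sub, enorm_mul, mul_left_comm]
  gcongr
  rw [← sub_apply, ← ofReal_norm, ← ofReal_norm, ← ENNReal.ofReal_mul
    ((Finset.prod_nonneg fun _ _ => norm_nonneg _).trans hV)]
  apply ENNReal.ofReal_le_ofReal
  rw [mul_comm]
  exact (ContinuousMultilinearMap.le_opNorm _ w).trans (by gcongr)

/-- The reproducing weights are applied to s ↦ (ψ * D^ℓ u)(x + s h)[v]. Its derivatives `A j` are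
written with u against derivatives of ψ; only the orders ℓ and ℓ + m + 1 are converted back to weak
derivatives. -/
theorem enorm_mollified_sub_sum_weights_le {N ℓ m : ℕ} {c τ : Fin (m + 2) → ℝ}
    (hτ : ∀ i, τ i ∈ Set.Ioo (0 : ℝ) 1)
    (hc : ∀ j < m + 2, ∑ i, c i * τ i ^ j = (0 : ℝ) ^ j)
    {u : EuclideanSpace ℝ (Fin N) → ℝ}
    {g : EuclideanSpace ℝ (Fin N) →
      ContinuousMultilinearMap ℝ (fun _ : Fin ℓ => EuclideanSpace ℝ (Fin N)) ℝ}
    (hg : HasWeakDeriv ℓ u g)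
    {G : EuclideanSpace ℝ (Fin N) →
      ContinuousMultilinearMap ℝ (fun _ : Fin (ℓ + (m + 1)) => EuclideanSpace ℝ (Fin N)) ℝ}
    (hG : HasWeakDeriv (ℓ + (m + 1)) u G)
    {ψ : EuclideanSpace ℝ (Fin N) → ℝ} (hψ : ContDiff ℝ ∞ ψ) (hψc : HasCompactSupport ψ)
    (x : EuclideanSpace ℝ (Fin N)) {h : EuclideanSpace ℝ (Fin N)} (hh : ‖h‖ ≤ 1)
    (v : Fin ℓ → EuclideanSpace ℝ (Fin N)) {r : ℝ} (hr : 0 ≤ r) :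
    ‖(∫ y, ψ (x - y) * g y v) - ∑ i, c i * ∫ y, ψ (x + (τ i * r) • h - y) * g y v‖ₑ ≤
      ENNReal.ofReal ((∑ i, |c i|) * r ^ m) * ENNReal.ofReal (∏ i, ‖v i‖) *
        ∫⁻ s in Set.Ioc 0 r, ∫⁻ z, ‖ψ z‖ₑ * ‖G (x - z + s • h) - G (x - z)‖ₑ := by
  let A : ℕ → ℝ → ℝ := fun j s =>
    ∫ y, u y * iteratedFDeriv ℝ (ℓ + j) ψ (x + s • h - y) (prependCopies h v j)
  have hA : ∀ j, ∀ s, HasDerivAt (A j) (A (j + 1) s) s := fun j s =>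
    hasDerivAt_integral_mul_iteratedFDeriv hg.1 hψ hψc x h (prependCopies h v j) s
  have hcont : Continuous (A (m + 1)) :=
    continuous_iff_continuousAt.2 fun s => (hA (m + 1) s).continuousAt
  have hA0 : ∀ s, A 0 s = ∫ y, ψ (x + s • h - y) * g y v := fun s =>
    hg.integral_mul_iteratedFDeriv_eq hψ hψc _ v
  have hAm : ∀ s, A (m + 1) s = ∫ y, ψ (x + s • h - y) * G y (prependCopies h v (m + 1)) :=
    fun s => hG.integral_mul_iteratedFDeriv_eq hψ hψc _ _
  have H := abs_sub_sum_weights_le hτ hc A (fun j _ => hA j) hcont hr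
  have hV : ∏ i, ‖prependCopies h v (m + 1) i‖ ≤ ∏ i, ‖v i‖ := by
    rw [prod_norm_prependCopies]
    exact mul_le_of_le_one_left (Finset.prod_nonneg fun _ _ => norm_nonneg _)
      (pow_le_one₀ (norm_nonneg _) hh)
  have hE : (∫ y, ψ (x - y) * g y v) - ∑ i, c i * ∫ y, ψ (x + (τ i * r) • h - y) * g y v =
      A 0 0 - ∑ i, c i * A 0 (τ i * r) := by
    simp [hA0]
  have hI : ENNReal.ofReal (∫ s in (0 : ℝ)..r, |A (m + 1) s - A (m + 1) 0|) ≤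
      ∫⁻ s in Set.Ioc 0 r, ENNReal.ofReal (∏ i, ‖v i‖) *
        ∫⁻ z, ‖ψ z‖ₑ * ‖G (x - z + s • h) - G (x - z)‖ₑ := by
    rw [intervalIntegral.integral_of_le hr]
    refine (Real.ofReal_le_enorm _).trans ((enorm_integral_le_lintegral_enorm _).trans ?_)
    refine lintegral_mono fun s => ?_
    rw [Real.enorm_abs, hAm, hAm, zero_smul, add_zero]
    exact enorm_integral_mul_apply_sub_le hG.2.1 hψ.continuous hψc x (s • h) _ hV
  rw [lintegral_const_mul' _ _ ENNReal.ofReal_ne_top] at hI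
  rw [hE, Real.enorm_eq_ofReal_abs]
  refine (ENNReal.ofReal_le_ofReal H).trans ?_
  rw [← mul_assoc, ENNReal.ofReal_mul (by positivity), mul_assoc]
  gcongr

/-- By Tonelli the integral in h is taken first, at fixed centre x - z and scale s, where `hK`
applies. Since s^σ ≤ r^σ, integrating over (0, r] gives r^(1+σ). -/
theorem lintegral_bump_mul_increments_le {N : ℕ} {F : Type*} [NormedAddCommGroup F] {σ p : ℝ}
    (hσ : 0 < σ) {η ψ : EuclideanSpace ℝ (Fin N) → ℝ} (hη : Continuous η) (hψ : Continuous ψ)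
    {G : EuclideanSpace ℝ (Fin N) → F} (hG : StronglyMeasurable G) {K : ℝ≥0}
    (hK : ∀ (c : EuclideanSpace ℝ (Fin N)) (s : ℝ), 0 < s →
        ∫⁻ h, ‖η h‖ₑ * ‖G (c + s • h) - G c‖ₑ ≤
          K * ENNReal.ofReal (s ^ σ) * localGagliardo σ p G c)
    (x : EuclideanSpace ℝ (Fin N)) {r : ℝ} (hr : 0 < r) :
    ∫⁻ h, ‖η h‖ₑ * ∫⁻ s in Set.Ioc 0 r, ∫⁻ z, ‖ψ z‖ₑ * ‖G (x - z + s • h) - G (x - z)‖ₑ ≤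
      K * ENNReal.ofReal (r ^ (1 + σ)) * ∫⁻ z, ‖ψ z‖ₑ * localGagliardo σ p G (x - z) := by
  have hηm : Measurable η := hη.measurable
  have hψm : Measurable ψ := hψ.measurable
  have hm : Measurable fun q : EuclideanSpace ℝ (Fin N) × ℝ × EuclideanSpace ℝ (Fin N) =>
      ‖η q.1‖ₑ * (‖ψ q.2.2‖ₑ * ‖G (x - q.2.2 + q.2.1 • q.1) - G (x - q.2.2)‖ₑ) := by
    have h1 : Measurable fun q : EuclideanSpace ℝ (Fin N) × ℝ × EuclideanSpace ℝ (Fin N) =>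
        ‖G (x - q.2.2 + q.2.1 • q.1) - G (x - q.2.2)‖ₑ :=
      ((hG.comp_measurable (by fun_prop)).sub (hG.comp_measurable (by fun_prop))).enorm
    have h2 : Measurable fun q : EuclideanSpace ℝ (Fin N) × ℝ × EuclideanSpace ℝ (Fin N) =>
        ‖η q.1‖ₑ := by fun_prop
    have h3 : Measurable fun q : EuclideanSpace ℝ (Fin N) × ℝ × EuclideanSpace ℝ (Fin N) =>
        ‖ψ q.2.2‖ₑ := by fun_prop
    exact h2.mul (h3.mul h1)
  have e1 : ∀ h, ‖η h‖ₑ * ∫⁻ s in Set.Ioc 0 r, ∫⁻ z, ‖ψ z‖ₑ * ‖G (x - z + s • h) - G (x - z)‖ₑ =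
      ∫⁻ s in Set.Ioc 0 r, ∫⁻ z, ‖η h‖ₑ * (‖ψ z‖ₑ * ‖G (x - z + s • h) - G (x - z)‖ₑ) := by
    intro h
    rw [← lintegral_const_mul' _ _ enorm_ne_top]
    refine lintegral_congr fun s => ?_
    rw [← lintegral_const_mul' _ _ enorm_ne_top]
  simp_rw [e1]
  have e2 : ∫⁻ h, ∫⁻ s in Set.Ioc 0 r, ∫⁻ z, ‖η h‖ₑ * (‖ψ z‖ₑ * ‖G (x - z + s • h) - G (x - z)‖ₑ) =
      ∫⁻ s in Set.Ioc 0 r, ∫⁻ h, ∫⁻ z, ‖η h‖ₑ * (‖ψ z‖ₑ * ‖G (x - z + s • h) - G (x - z)‖ₑ) := by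
    refine lintegral_lintegral_swap (Measurable.aemeasurable ?_)
    have : Measurable fun q : (EuclideanSpace ℝ (Fin N) × ℝ) × EuclideanSpace ℝ (Fin N) =>
        ‖η q.1.1‖ₑ * (‖ψ q.2‖ₑ * ‖G (x - q.2 + q.1.2 • q.1.1) - G (x - q.2)‖ₑ) :=
      hm.comp (g := fun q => _) (f := fun q : (EuclideanSpace ℝ (Fin N) × ℝ) ×
        EuclideanSpace ℝ (Fin N) => (q.1.1, q.1.2, q.2)) (by fun_prop)
    exact this.lintegral_prod_right'
  rw [e2]
  have e3 : ∀ s ∈ Set.Ioc 0 r,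
      ∫⁻ h, ∫⁻ z, ‖η h‖ₑ * (‖ψ z‖ₑ * ‖G (x - z + s • h) - G (x - z)‖ₑ) ≤
        K * ENNReal.ofReal (r ^ σ) * ∫⁻ z, ‖ψ z‖ₑ * localGagliardo σ p G (x - z) := by
    intro s hs
    have hms : Measurable (Function.uncurry fun h z : EuclideanSpace ℝ (Fin N) =>
        ‖η h‖ₑ * (‖ψ z‖ₑ * ‖G (x - z + s • h) - G (x - z)‖ₑ)) :=
      hm.comp (f := fun q : EuclideanSpace ℝ (Fin N) ×
        EuclideanSpace ℝ (Fin N) => (q.1, s, q.2)) (by fun_prop)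
    rw [lintegral_lintegral_swap hms.aemeasurable,
      ← lintegral_const_mul' _ _ (ENNReal.mul_ne_top ENNReal.coe_ne_top ENNReal.ofReal_ne_top)]
    refine lintegral_mono fun z => ?_
    simp_rw [mul_left_comm ‖η _‖ₑ]
    rw [lintegral_const_mul' _ _ enorm_ne_top, mul_left_comm]
    gcongr
    refine (hK (x - z) s hs.1).trans ?_
    gcongr
    · exact hs.1.le
    · exact hs.2
  refine (setLIntegral_mono' measurableSet_Ioc e3).trans ?_
  rw [setLIntegral_const, Real.volume_Ioc, sub_zero, Real.rpow_add hr, Real.rpow_one,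
    ENNReal.ofReal_mul hr.le]
  exact le_of_eq (by ring)

/-! ### The pointwise interpolation estimate. -/

/-- A mollification of `D^ℓ u` is controlled at every point by the Campanato seminorm of `u` and
the mollified local Gagliardo energy of `D^k u`, where `k = ℓ + m + 1`. -/
theorem exists_enorm_mollified_le {N : ℕ} (ℓ m : ℕ) {σ p : ℝ} (lam : ℝ) (hp : 1 ≤ p)
    (hσ : 0 < σ) :
    ∃ K : ℝ≥0, ∀ (u : EuclideanSpace ℝ (Fin N) → ℝ) (g : EuclideanSpace ℝ (Fin N) →
      ContinuousMultilinearMap ℝ (fun _ : Fin ℓ => EuclideanSpace ℝ (Fin N)) ℝ)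
      (G : EuclideanSpace ℝ (Fin N) →
      ContinuousMultilinearMap ℝ (fun _ : Fin (ℓ + (m + 1)) => EuclideanSpace ℝ (Fin N)) ℝ),
      HasWeakDeriv ℓ u g → HasWeakDeriv (ℓ + (m + 1)) u G →
      StronglyMeasurable g → StronglyMeasurable G →
      ∀ ψ : EuclideanSpace ℝ (Fin N) → ℝ, ContDiff ℝ ∞ ψ → HasCompactSupport ψ →
      ∫⁻ z, ‖ψ z‖ₑ = 1 → ∀ (ρ r : ℝ), 0 < r → r < ρ →
      ∀ (x : EuclideanSpace ℝ (Fin N)) (v : Fin ℓ → EuclideanSpace ℝ (Fin N)),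
        ‖∫ y, ψ (x - y) * g y v‖ₑ ≤ K * ENNReal.ofReal (∏ i, ‖v i‖) *
          (ENNReal.ofReal (r ^ (-(ℓ : ℝ) - lam)) * campanatoSeminorm lam ℓ ρ u +
            ENNReal.ofReal (r ^ ((m : ℝ) + 1 + σ)) *
              ∫⁻ z, ‖ψ z‖ₑ * localGagliardo σ p G (x - z)) := by
  let b : ContDiffBump (0 : EuclideanSpace ℝ (Fin N)) := ⟨1 / 4, 1 / 2, by norm_num, by norm_num⟩
  set η : EuclideanSpace ℝ (Fin N) → ℝ := b.normed volume with hηdef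
  have hη : ContDiff ℝ ∞ η := b.contDiff_normed
  have hηc : HasCompactSupport η := b.hasCompactSupport_normed
  have hηs : tsupport η ⊆ Metric.ball 0 1 := by
    rw [hηdef, b.tsupport_normed_eq]
    exact Metric.closedBall_subset_ball (by norm_num)
  have hη1 : ∫ h, η h = 1 := b.integral_normed
  obtain ⟨c, τ, hτ, hc⟩ := exists_weights_reproducing (m + 2)
  obtain ⟨K₁, hK₁⟩ := exists_enorm_integral_bump_mul_le_campanatoSeminorm ℓ hη hηc hηs
  obtain ⟨K₂, hK₂⟩ := exists_lintegral_bump_mul_le_localGagliardo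
    (G := ContinuousMultilinearMap ℝ (fun _ : Fin (ℓ + (m + 1)) => EuclideanSpace ℝ (Fin N)) ℝ)
    hp hσ hη.continuous hηc hηs
  -- The Campanato bound is used at the scales τ_i r; the powers of τ_i go into the constant.
  set C₁ : ℝ≥0 := ∑ i, ‖c i‖₊ * (K₁ * (τ i ^ (-(ℓ : ℝ) - lam)).toNNReal) with hC₁
  set C₂ : ℝ≥0 := (∑ i, |c i|).toNNReal * K₂ with hC₂
  refine ⟨C₁ + C₂, fun u g G hg hG hgm hGm ψ hψ hψc hψ1 ρ r hr hrρ x v => ?_⟩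
  set V : ℝ := ∏ i, ‖v i‖ with hV
  set W : EuclideanSpace ℝ (Fin N) → ℝ := fun a => ∫ y, ψ (a - y) * g y v with hW
  set M := campanatoSeminorm lam ℓ ρ u with hM
  have hgv := hg.2.1.continuousMultilinearMap_apply v
  have hgvm : StronglyMeasurable fun y => g y v :=
    (ContinuousMultilinearMap.apply ℝ
      (fun _ : Fin ℓ => EuclideanSpace ℝ (Fin N)) ℝ v).continuous.comp_stronglyMeasurable hgm
  have hWc : Continuous W := continuous_integral_mul_comp_sub hgv hψ.continuous hψc
  have hint : ∀ t : ℝ, Integrable fun h => η h * W (x + t • h) := fun t =>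
    (hη.continuous.mul (hWc.comp (by fun_prop))).integrable_of_hasCompactSupport hηc.mul_right
  -- Since η has integral 1, W x is its own average over h.
  have hsplit : W x = ∑ i, c i * (∫ h, η h * W (x + (τ i * r) • h)) +
      ∫ h, η h * (W x - ∑ i, c i * W (x + (τ i * r) • h)) := by
    have e1 : ∫ h, η h * W x = W x := by rw [integral_mul_const, hη1, one_mul]
    have e2 : ∀ h, η h * (W x - ∑ i, c i * W (x + (τ i * r) • h)) =
        η h * W x - ∑ i, c i * (η h * W (x + (τ i * r) • h)) := by
      intro h
      rw [mul_sub, Finset.mul_sum]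
      congr 1
      exact Finset.sum_congr rfl fun i _ => by ring
    simp_rw [e2]
    rw [integral_sub ((hη.continuous.integrable_of_hasCompactSupport hηc).mul_const _)
      (integrable_finsetSum _ fun i _ => (hint _).const_mul _),
      integral_finsetSum _ fun i _ => (hint _).const_mul _, e1]
    simp_rw [integral_const_mul]
    ring
  have hmain : ∀ i, ‖∫ h, η h * W (x + (τ i * r) • h)‖ₑ ≤
      K₁ * ENNReal.ofReal V * (ENNReal.ofReal ((τ i * r) ^ (-(ℓ : ℝ) - lam)) * M) := by
    intro i
    have ht0 : 0 < τ i * r := mul_pos (hτ i).1 hr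
    have ht1 : τ i * r < ρ := (mul_le_of_le_one_left hr.le (hτ i).2.le).trans_lt hrρ
    rw [integral_bump_mul_mollified_swap hη.continuous hηc hψ.continuous hψc hgv hgvm]
    refine (enorm_integral_le_lintegral_enorm _).trans ?_
    calc ∫⁻ z, ‖ψ z * ∫ h, η h * g (x - z + (τ i * r) • h) v‖ₑ
        ≤ ∫⁻ z, ‖ψ z‖ₑ * (K₁ * ENNReal.ofReal V *
            (ENNReal.ofReal ((τ i * r) ^ (-(ℓ : ℝ) - lam)) * M)) := by
          refine lintegral_mono fun z => ?_
          rw [enorm_mul]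
          gcongr
          exact hK₁ u g hg lam ρ _ ht0 ht1 (x - z) v
      _ = _ := by
          rw [lintegral_mul_const _ hψ.continuous.measurable.enorm, hψ1, one_mul]
  have hrem : ‖∫ h, η h * (W x - ∑ i, c i * W (x + (τ i * r) • h))‖ₑ ≤
      C₂ * ENNReal.ofReal V * (ENNReal.ofReal (r ^ ((m : ℝ) + 1 + σ)) *
              ∫⁻ z, ‖ψ z‖ₑ * localGagliardo σ p G (x - z)) := by
    refine (enorm_integral_le_lintegral_enorm _).trans ?_
    have hpt : ∀ h, ‖η h * (W x - ∑ i, c i * W (x + (τ i * r) • h))‖ₑ ≤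
        ENNReal.ofReal ((∑ i, |c i|) * r ^ m) * ENNReal.ofReal V *
          (‖η h‖ₑ * ∫⁻ s in Set.Ioc 0 r, ∫⁻ z, ‖ψ z‖ₑ * ‖G (x - z + s • h) - G (x - z)‖ₑ) := by
      intro h
      by_cases hh : h ∈ tsupport η
      · rw [enorm_mul, mul_left_comm]
        gcongr
        exact enorm_mollified_sub_sum_weights_le hτ hc hg hG hψ hψc x
          (mem_ball_zero_iff.1 (hηs hh)).le v hr.le
      · simp [image_eq_zero_of_notMem_tsupport hh]
    refine (lintegral_mono hpt).trans ?_
    rw [lintegral_const_mul' _ _ (ENNReal.mul_ne_top ENNReal.ofReal_ne_top ENNReal.ofReal_ne_top)]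
    refine (mul_le_mul_right (lintegral_bump_mul_increments_le hσ hη.continuous hψ.continuous hGm
      (hK₂ G hGm) x hr) _).trans (le_of_eq ?_)
    rw [hC₂, ENNReal.coe_mul, ENNReal.ofReal_mul (by positivity), add_assoc (m : ℝ),
      Real.rpow_add hr (m : ℝ), Real.rpow_natCast, ENNReal.ofReal_mul (by positivity)]
    simp only [ENNReal.ofReal]
    ring
  have hsum : ‖∑ i, c i * (∫ h, η h * W (x + (τ i * r) • h))‖ₑ ≤
      C₁ * ENNReal.ofReal V * (ENNReal.ofReal (r ^ (-(ℓ : ℝ) - lam)) * M) := by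
    refine (enorm_sum_le _ _).trans ?_
    rw [hC₁, ENNReal.ofNNReal_finsetSum, Finset.sum_mul, Finset.sum_mul]
    refine Finset.sum_le_sum fun i _ => ?_
    rw [enorm_mul]
    refine (mul_le_mul_right (hmain i) _).trans (le_of_eq ?_)
    rw [Real.mul_rpow (hτ i).1.le hr.le, ENNReal.ofReal_mul (Real.rpow_nonneg (hτ i).1.le _)]
    simp only [ENNReal.coe_mul, ENNReal.ofReal, enorm_eq_nnnorm]
    ring
  change ‖W x‖ₑ ≤ _
  rw [hsplit]
  refine (enorm_add_le _ _).trans ((add_le_add hsum hrem).trans ?_)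
  rw [mul_add, ENNReal.coe_add]
  gcongr
  · exact le_self_add
  · exact le_add_self

theorem measurable_localGagliardo {N : ℕ} {F : Type*} [NormedAddCommGroup F] (σ p : ℝ)
    {G : EuclideanSpace ℝ (Fin N) → F} (hG : StronglyMeasurable G) :
    Measurable (localGagliardo σ p G) := by
  have h1 : Measurable fun q : EuclideanSpace ℝ (Fin N) × EuclideanSpace ℝ (Fin N) =>
      ‖G q.1 - G q.2‖ₑ :=
    ((hG.comp_measurable measurable_fst).sub (hG.comp_measurable measurable_snd)).enorm
  have h2 : Measurable fun q : EuclideanSpace ℝ (Fin N) × EuclideanSpace ℝ (Fin N) =>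
      ‖q.1 - q.2‖ₑ := by fun_prop
  exact (((h1.pow_const p).div (h2.pow_const ((N : ℝ) + σ * p))).lintegral_prod_right').pow_const _

theorem localGagliardo_rpow {N : ℕ} {F : Type*} [NormedAddCommGroup F] (σ : ℝ) {p : ℝ}
    (hp : p ≠ 0) (G : EuclideanSpace ℝ (Fin N) → F) (x : EuclideanSpace ℝ (Fin N)) :
    localGagliardo σ p G x ^ p =
      ∫⁻ y, ‖G x - G y‖ₑ ^ p / ‖x - y‖ₑ ^ ((N : ℝ) + σ * p) := by
  rw [localGagliardo, ← ENNReal.rpow_mul, one_div_mul_cancel hp, ENNReal.rpow_one]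

theorem lintegral_localGagliardo_rpow {N : ℕ} {F : Type*} [NormedAddCommGroup F] (σ : ℝ) {p : ℝ}
    (hp : p ≠ 0) (G : EuclideanSpace ℝ (Fin N) → F) :
    ∫⁻ x, localGagliardo σ p G x ^ p = gagliardoEnergy σ p G :=
  lintegral_congr fun x => localGagliardo_rpow σ hp G x

/-- Needed to apply Lebesgue differentiation to the mollified local energy; finite energy puts it in
L^p with p ≥ 1. -/
theorem locallyIntegrable_toReal_localGagliardo {N : ℕ} {F : Type*} [NormedAddCommGroup F]
    {σ p : ℝ} (hp : 1 ≤ p) {G : EuclideanSpace ℝ (Fin N) → F} (hG : StronglyMeasurable G)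
    (hfin : gagliardoEnergy σ p G < ⊤) :
    LocallyIntegrable (fun x => (localGagliardo σ p G x).toReal) volume := by
  have hp0 : 0 < p := by linarith
  have hL : MemLp (fun x => (localGagliardo σ p G x).toReal) (ENNReal.ofReal p) volume := by
    refine ⟨(measurable_localGagliardo σ p hG).ennreal_toReal.aestronglyMeasurable, ?_⟩
    rw [eLpNorm_lt_top_iff_lintegral_rpow_enorm_lt_top (by simpa using hp0) ENNReal.ofReal_ne_top,
      ENNReal.toReal_ofReal hp0.le]
    rw [← lintegral_localGagliardo_rpow σ hp0.ne'] at hfin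
    refine (lintegral_mono fun x => ENNReal.rpow_le_rpow ?_ hp0.le).trans_lt hfin
    rw [Real.enorm_of_nonneg ENNReal.toReal_nonneg]
    exact ENNReal.ofReal_toReal_le
  exact hL.locallyIntegrable (by simpa using hp)

/-- Returns from the estimates in fixed directions v to the norm of D^ℓ u. -/
theorem ContinuousMultilinearMap.enorm_le_of_forall_enorm_apply_le {E : Type*}
    [NormedAddCommGroup E] [NormedSpace ℝ E] {ℓ : ℕ}
    {L : ContinuousMultilinearMap ℝ (fun _ : Fin ℓ => E) ℝ} {B : ℝ≥0∞}
    (h : ∀ v : Fin ℓ → E, ‖L v‖ₑ ≤ B * ENNReal.ofReal (∏ i, ‖v i‖)) : ‖L‖ₑ ≤ B := by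
  rcases eq_or_ne B ⊤ with rfl | hB
  · exact le_top
  rw [← ofReal_norm, ENNReal.ofReal_le_iff_le_toReal hB]
  refine ContinuousMultilinearMap.opNorm_le_bound ENNReal.toReal_nonneg fun v => ?_
  have hv : 0 ≤ ∏ i, ‖v i‖ := Finset.prod_nonneg fun _ _ => norm_nonneg _
  have := h v
  rw [← ofReal_norm, ENNReal.ofReal_le_iff_le_toReal (ENNReal.mul_ne_top hB ENNReal.ofReal_ne_top),
    ENNReal.toReal_mul, ENNReal.toReal_ofReal hv] at this
  exact this

/-- Pointwise interpolation of `D^ℓ u` between the Campanato seminorm of `u` and the local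
Gagliardo energy of `D^k u`, where `k = ℓ + m + 1`. -/
theorem exists_ae_enorm_weakDeriv_le {N : ℕ} (ℓ m : ℕ) {σ p : ℝ} (lam : ℝ) (hp : 1 ≤ p)
    (hσ : 0 < σ) :
    ∃ K : ℝ≥0, ∀ (u : EuclideanSpace ℝ (Fin N) → ℝ) (g : EuclideanSpace ℝ (Fin N) →
      ContinuousMultilinearMap ℝ (fun _ : Fin ℓ => EuclideanSpace ℝ (Fin N)) ℝ)
      (G : EuclideanSpace ℝ (Fin N) →
      ContinuousMultilinearMap ℝ (fun _ : Fin (ℓ + (m + 1)) => EuclideanSpace ℝ (Fin N)) ℝ),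
      HasWeakDeriv ℓ u g → HasWeakDeriv (ℓ + (m + 1)) u G →
      StronglyMeasurable g → StronglyMeasurable G → gagliardoEnergy σ p G < ⊤ →
      ∀ ρ : ℝ, ∀ᵐ x, ∀ r : ℝ, 0 < r → r < ρ →
        ‖g x‖ₑ ≤ K * (ENNReal.ofReal (r ^ (-(ℓ : ℝ) - lam)) * campanatoSeminorm lam ℓ ρ u +
          ENNReal.ofReal (r ^ ((m : ℝ) + 1 + σ)) * localGagliardo σ p G x) := by
  obtain ⟨K, hK⟩ := exists_enorm_mollified_le (N := N) ℓ m lam hp hσ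
  refine ⟨K, fun u g G hg hG hgm hGm hfin ρ => ?_⟩
  have hp0 : 0 < p := by linarith
  have hEm := measurable_localGagliardo σ p hGm
  have hEli := locallyIntegrable_toReal_localGagliardo hp hGm hfin
  have hEfin : ∀ᵐ x, localGagliardo σ p G x < ⊤ := by
    rw [← lintegral_localGagliardo_rpow σ hp0.ne'] at hfin
    filter_upwards [ae_lt_top (hEm.pow_const p) hfin.ne] with x hx
    exact (ENNReal.rpow_lt_top_iff_of_pos hp0).1 hx
  -- The outer radii tend to 0 and stay twice the inner ones, as the differentiation theorem
  -- requires.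
  let φ : ℕ → ContDiffBump (0 : EuclideanSpace ℝ (Fin N)) := fun n =>
    ⟨1 / ((n : ℝ) + 1), 2 * (1 / ((n : ℝ) + 1)), by positivity, by
      have : 0 < 1 / ((n : ℝ) + 1) := by positivity
      linarith⟩
  have hφ0 : Filter.Tendsto (fun n => (φ n).rOut) Filter.atTop (nhds 0) := by
    have := (tendsto_one_div_add_atTop_nhds_zero_nat (𝕜 := ℝ)).const_mul (2 : ℝ)
    rw [mul_zero] at this
    exact this
  have hφK : ∀ᶠ n in Filter.atTop, (φ n).rOut ≤ 2 * (φ n).rIn :=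
    Filter.Eventually.of_forall fun n => le_rfl
  -- Neither limit involves r, so one null set serves all scales.
  filter_upwards [ContDiffBump.ae_convolution_tendsto_right_of_locallyIntegrable hφ0 hφK hg.2.1,
    ContDiffBump.ae_convolution_tendsto_right_of_locallyIntegrable hφ0 hφK hEli] with x hx1 hx2
  intro r hr hrρ
  have hbound : ∀ n, ‖(convolution ((φ n).normed volume) g
      (ContinuousLinearMap.lsmul ℝ ℝ) volume) x‖ₑ ≤
      K * (ENNReal.ofReal (r ^ (-(ℓ : ℝ) - lam)) * campanatoSeminorm lam ℓ ρ u +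
          ENNReal.ofReal (r ^ ((m : ℝ) + 1 + σ)) * ENNReal.ofReal
            ((convolution ((φ n).normed volume) (fun x => (localGagliardo σ p G x).toReal)
              (ContinuousLinearMap.lsmul ℝ ℝ) volume) x)) := by
    intro n
    set ψ := (φ n).normed volume with hψdef
    have hψ : ContDiff ℝ ∞ ψ := (φ n).contDiff_normed
    have hψc : HasCompactSupport ψ := (φ n).hasCompactSupport_normed
    have hψ0 : ∀ z, 0 ≤ ψ z := (φ n).nonneg_normed
    have hψ1 : ∫⁻ z, ‖ψ z‖ₑ = 1 := by
      have h1 : ∫ z, ψ z = 1 := (φ n).integral_normed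
      simp_rw [fun z => Real.enorm_of_nonneg (hψ0 z)]
      rw [← ofReal_integral_eq_lintegral_ofReal (φ n).integrable_normed
        (Filter.Eventually.of_forall hψ0), h1, ENNReal.ofReal_one]
    have hconv : ENNReal.ofReal ((convolution ψ (fun x => (localGagliardo σ p G x).toReal)
        (ContinuousLinearMap.lsmul ℝ ℝ) volume) x) =
        ∫⁻ z, ‖ψ z‖ₑ * localGagliardo σ p G (x - z) := by
      have hi : Integrable fun z => ψ z * (localGagliardo σ p G (x - z)).toReal :=
        hψc.convolutionExists_left (ContinuousLinearMap.lsmul ℝ ℝ) hψ.continuous hEli x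
      rw [convolution_def]
      simp only [ContinuousLinearMap.lsmul_apply, smul_eq_mul]
      rw [ofReal_integral_eq_lintegral_ofReal hi (Filter.Eventually.of_forall fun z =>
        mul_nonneg (hψ0 z) ENNReal.toReal_nonneg)]
      refine lintegral_congr_ae ?_
      have hq := (quasiMeasurePreserving_sub_left volume x).ae hEfin
      filter_upwards [hq] with z hz
      rw [ENNReal.ofReal_mul (hψ0 z), ENNReal.ofReal_toReal hz.ne, Real.enorm_of_nonneg (hψ0 z)]
    rw [hconv]
    refine ContinuousMultilinearMap.enorm_le_of_forall_enorm_apply_le fun v => ?_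
    have hi : Integrable fun y => ψ (x - y) • g y :=
      (hψc.convolutionExists_left (ContinuousLinearMap.lsmul ℝ ℝ) hψ.continuous hg.2.1
        x).integrable_swap
    have hv : (convolution ψ g (ContinuousLinearMap.lsmul ℝ ℝ) volume) x v =
        ∫ y, ψ (x - y) * g y v := by
      rw [convolution_eq_swap]
      simp only [ContinuousLinearMap.lsmul_apply]
      have := (ContinuousMultilinearMap.apply ℝ
        (fun _ : Fin ℓ => EuclideanSpace ℝ (Fin N)) ℝ v).integral_comp_comm hi
      simpa using this.symm
    rw [hv]
    refine (hK u g G hg hG hgm hGm ψ hψ hψc hψ1 ρ r hr hrρ x v).trans (le_of_eq (by ring))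
  have hlim := le_of_tendsto_of_tendsto' hx1.enorm (ENNReal.Tendsto.const_mul
    (tendsto_const_nhds.add (ENNReal.Tendsto.const_mul (ENNReal.tendsto_ofReal hx2)
      (Or.inr ENNReal.ofReal_ne_top))) (Or.inr ENNReal.coe_ne_top)) hbound
  refine hlim.trans ?_
  gcongr
  exact ENNReal.ofReal_toReal_le

/-! ### Optimization over the scale and rescaling. -/

/-- Optimization over the scale in an interpolation inequality. -/
theorem exists_rpow_le_of_forall_scale_le {α β p q K : ℝ} (hα : 0 ≤ α) (hβ : 0 < β) (hp : 0 < p)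
    (hpq : p < q) (hαβ : α * (q - p) ≤ β * p) (hK : 0 ≤ K) :
    ∃ C : ℝ, 0 ≤ C ∧ ∀ b m e : ℝ, 0 ≤ b → 0 ≤ m → 0 ≤ e →
      (∀ t : ℝ, 0 < t → t < 1 → b ≤ K * (t ^ (-α) * m + t ^ β * e)) →
        b ^ q ≤ C * m ^ (q - p) * (e ^ p + b ^ p) := by
  have hq : 0 < q := hp.trans hpq
  refine ⟨(2 * K) ^ q + (K * ((1 / 2 : ℝ) ^ (-α) + 1)) ^ (q - p), by positivity, ?_⟩
  intro b m e hb hm he h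
  -- If e ≤ m, the scale t = 1/2 bounds b by a multiple of m, and b^q = b^(q-p) b^p produces the
  -- term b^p. If m < e, the balancing scale is below 1 and available. The two summands of the
  -- constant belong to these cases.
  rcases le_or_gt e m with hem | hme
  · have h1 : b ≤ K * ((1 / 2 : ℝ) ^ (-α) + 1) * m := by
      refine (h (1 / 2) (by norm_num) (by norm_num)).trans ?_
      rw [mul_assoc, add_mul]
      gcongr
      exact Real.rpow_le_one (by norm_num) (by norm_num) hβ.le
    calc b ^ q = b ^ (q - p) * b ^ p := by
          rcases hb.eq_or_lt with rfl | hb'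
          · rw [Real.zero_rpow hq.ne', Real.zero_rpow hp.ne', mul_zero]
          · rw [← Real.rpow_add hb', sub_add_cancel]
      _ ≤ (K * ((1 / 2 : ℝ) ^ (-α) + 1) * m) ^ (q - p) * b ^ p := by
          gcongr
      _ = (K * ((1 / 2 : ℝ) ^ (-α) + 1)) ^ (q - p) * m ^ (q - p) * b ^ p := by
          rw [Real.mul_rpow (by positivity) hm]
      _ ≤ _ := by
          gcongr
          · exact le_add_of_nonneg_left (by positivity)
          · exact le_add_of_nonneg_left (by positivity)
  · rcases hm.eq_or_lt with rfl | hm'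
    · have hlim : Filter.Tendsto (fun t : ℝ => K * (t ^ (-α) * 0 + t ^ β * e))
          (nhdsWithin 0 (Set.Ioi 0)) (nhds 0) := by
        have : Filter.Tendsto (fun t : ℝ => t ^ β) (nhdsWithin 0 (Set.Ioi 0)) (nhds 0) := by
          have := (Real.continuousAt_rpow_const 0 β (Or.inr hβ.le)).tendsto.mono_left
            (nhdsWithin_le_nhds (s := Set.Ioi 0))
          rwa [Real.zero_rpow hβ.ne'] at this
        simpa using (this.mul_const e).const_mul K
      have hb0 : b ≤ 0 := by
        refine ge_of_tendsto hlim ?_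
        filter_upwards [Ioo_mem_nhdsGT (zero_lt_one' ℝ)] with t ht
        exact h t ht.1 ht.2
      obtain rfl : b = 0 := le_antisymm hb0 hb
      rw [Real.zero_rpow hq.ne']
      positivity
    · have he' : 0 < e := hm'.trans hme
      have hαβ' : 0 < α + β := by linarith
      set τ : ℝ := (m / e) ^ (1 / (α + β)) with hτ
      have hme0 : 0 < m / e := by positivity
      have hτ0 : 0 < τ := by positivity
      have hτ1 : τ < 1 := Real.rpow_lt_one hme0.le ((div_lt_one he').2 hme) (by positivity)
      have hτp : τ ^ (α + β) = m / e := by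
        rw [hτ, ← Real.rpow_mul hme0.le, one_div_mul_cancel hαβ'.ne', Real.rpow_one]
      have heq : τ ^ β * e = τ ^ (-α) * m := by
        have : τ ^ β = τ ^ (-α) * τ ^ (α + β) := by rw [← Real.rpow_add hτ0]; congr 1; ring
        rw [this, hτp]
        field_simp
      have h1 : b ≤ 2 * K * τ ^ (-α) * m := by
        refine (h τ hτ0 hτ1).trans (le_of_eq ?_)
        rw [heq]; ring
      -- Here `hαβ` enters: it says αq ≤ (α + β)p, and τ < 1.
      have h2 : τ ^ (-α * q) ≤ (e / m) ^ p := by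
        have : (e / m) ^ p = τ ^ (-((α + β) * p)) := by
          rw [Real.rpow_neg hτ0.le, Real.rpow_mul hτ0.le, hτp, ← Real.inv_rpow hme0.le, inv_div]
        rw [this]
        exact Real.rpow_le_rpow_of_exponent_ge hτ0 hτ1.le (by nlinarith)
      calc b ^ q ≤ (2 * K * τ ^ (-α) * m) ^ q := by gcongr
        _ = (2 * K) ^ q * τ ^ (-α * q) * m ^ q := by
            rw [Real.mul_rpow (by positivity) hm, Real.mul_rpow (by positivity) (by positivity),
              ← Real.rpow_mul hτ0.le]
        _ ≤ (2 * K) ^ q * (e / m) ^ p * m ^ q := by gcongr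
        _ = (2 * K) ^ q * m ^ (q - p) * e ^ p := by
            rw [Real.div_rpow he hm, Real.rpow_sub hm']
            field_simp
        _ ≤ _ := by
            gcongr
            · exact le_add_of_nonneg_right (by positivity)
            · exact le_add_of_nonneg_right (by positivity)

theorem HasWeakDeriv.congr_ae {N j : ℕ} {u : EuclideanSpace ℝ (Fin N) → ℝ}
    {g g' : EuclideanSpace ℝ (Fin N) →
      ContinuousMultilinearMap ℝ (fun _ : Fin j => EuclideanSpace ℝ (Fin N)) ℝ}
    (hg : HasWeakDeriv j u g) (h : g =ᵐ[volume] g') : HasWeakDeriv j u g' := by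
  refine ⟨hg.1, fun x => ?_, fun φ hφ hc v => ?_⟩
  · obtain ⟨U, hU, hi⟩ := hg.2.1 x
    exact ⟨U, hU, hi.congr (ae_restrict_of_ae h)⟩
  · rw [hg.2.2 φ hφ hc v]
    congr 1
    refine integral_congr_ae ?_
    filter_upwards [h] with x hx
    rw [hx]

theorem gagliardoEnergy_congr_ae {N : ℕ} {F : Type*} [NormedAddCommGroup F] (σ p : ℝ)
    {G G' : EuclideanSpace ℝ (Fin N) → F} (h : G =ᵐ[volume] G') :
    gagliardoEnergy σ p G = gagliardoEnergy σ p G' := by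
  refine lintegral_congr_ae ?_
  filter_upwards [h] with x hx
  refine lintegral_congr_ae ?_
  filter_upwards [h] with y hy
  rw [hx, hy]

/-- The optimized pointwise estimate, rescaled to the scale `ρ`. -/
theorem exists_ofReal_mul_enorm_rpow_le {α β δ p q K lam : ℝ} (hα : 0 ≤ δ + lam)
    (hβ : 0 < β) (hp : 0 < p) (hpq : p < q) (hαβ : (δ + lam) * (q - p) ≤ β * p) (hK : 0 ≤ K)
    (hδ : α = δ + β) :
    ∃ C : ℝ≥0, ∀ (ρ : ℝ) (a M E : ℝ≥0∞), 0 < ρ → a ≠ ⊤ → M ≠ ⊤ → E ≠ ⊤ →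
      (∀ r : ℝ, 0 < r → r < ρ → a ≤ ENNReal.ofReal K *
        (ENNReal.ofReal (r ^ (-δ - lam)) * M + ENNReal.ofReal (r ^ β) * E)) →
      ENNReal.ofReal (ρ ^ (δ * q)) * a ^ q ≤ C * (ENNReal.ofReal (ρ ^ (-lam)) * M) ^ (q - p) *
        (ENNReal.ofReal (ρ ^ (p * α)) * E ^ p + ENNReal.ofReal (ρ ^ (δ * p)) * a ^ p) := by
  obtain ⟨C, hC0, hC⟩ := exists_rpow_le_of_forall_scale_le hα hβ hp hpq hαβ hK
  refine ⟨C.toNNReal, fun ρ a M E hρ ha hM hE h => ?_⟩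
  lift a to ℝ≥0 using ha
  lift M to ℝ≥0 using hM
  lift E to ℝ≥0 using hE
  have hq : 0 < q := hp.trans hpq
  -- The normalized quantities satisfy the hypothesis at t = r / ρ.
  have key := hC (ρ ^ δ * a) (ρ ^ (-lam) * M) (ρ ^ α * E) (by positivity) (by positivity)
    (by positivity) (fun t ht0 ht1 => by
      have htρ : t * ρ < ρ := mul_lt_of_lt_one_left hρ ht1
      have ht : 0 < t * ρ := mul_pos ht0 hρ
      have h1 := h (t * ρ) ht htρ
      rw [← ENNReal.ofReal_coe_nnreal (p := a), ← ENNReal.ofReal_coe_nnreal (p := M),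
        ← ENNReal.ofReal_coe_nnreal (p := E), ← ENNReal.ofReal_mul (by positivity),
        ← ENNReal.ofReal_mul (by positivity), ← ENNReal.ofReal_add (by positivity) (by positivity),
        ← ENNReal.ofReal_mul hK, ENNReal.ofReal_le_ofReal_iff (by positivity)] at h1
      calc ρ ^ δ * (a : ℝ) ≤ ρ ^ δ * (K * ((t * ρ) ^ (-δ - lam) * M + (t * ρ) ^ β * E)) := by
            gcongr
        _ = _ := by
            rw [Real.mul_rpow ht0.le hρ.le, Real.mul_rpow ht0.le hρ.le, hδ, Real.rpow_add hρ,
              show -lam = δ + (-δ - lam) by ring, Real.rpow_add hρ,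
              show -(δ + lam) = -δ - lam by ring]
            ring)
  have hpow : ∀ (b s : ℝ) (y : ℝ≥0), (ρ ^ b * (y : ℝ)) ^ s = ρ ^ (b * s) * (y : ℝ) ^ s :=
    fun b s y => by rw [Real.mul_rpow (by positivity) y.coe_nonneg, Real.rpow_mul hρ.le]
  rw [hpow _ q, hpow _ p, hpow _ p] at key
  have hqp : 0 < q - p := sub_pos.2 hpq
  rw [← ENNReal.ofReal_coe_nnreal (p := a), ← ENNReal.ofReal_coe_nnreal (p := M),
    ← ENNReal.ofReal_coe_nnreal (p := E), ENNReal.ofReal_rpow_of_nonneg a.coe_nonneg hq.le,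
    ENNReal.ofReal_rpow_of_nonneg a.coe_nonneg hp.le, ENNReal.ofReal_rpow_of_nonneg E.coe_nonneg hp.le,
    ← ENNReal.ofReal_mul (by positivity), ← ENNReal.ofReal_mul (by positivity),
    ENNReal.ofReal_rpow_of_nonneg (by positivity) hqp.le,
    ← ENNReal.ofReal_mul (by positivity), ← ENNReal.ofReal_mul (by positivity),
    ← ENNReal.ofReal_add (by positivity) (by positivity),
    show ((C.toNNReal : ℝ≥0) : ℝ≥0∞) = ENNReal.ofReal C from rfl,
    ← ENNReal.ofReal_mul hC0, ← ENNReal.ofReal_mul (by positivity), mul_comm p α]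
  exact ENNReal.ofReal_le_ofReal key

/-! ### Integration of the pointwise estimate. -/

theorem theorem2 (N k ℓ : ℕ) (hk : 1 ≤ k) (hℓ : ℓ ≤ k - 1) (p q σ lam : ℝ)
    (hp : 1 ≤ p) (hpq : p < q) (hσ0 : 0 < σ) (hσ1 : σ < 1)
    (hlam0 : -(ℓ : ℝ) ≤ lam) (hlam1 : lam ≤ (((k : ℝ) + σ) * p - ℓ * q) / (q - p)) :
    ∃ C : ℝ≥0, ∀ ρ : ℝ, 0 < ρ → ∀ u : EuclideanSpace ℝ (Fin N) → ℝ,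
      MemFracSobolevW k σ p u → MemCampanato lam ℓ ρ u →
        MemLp (weakDeriv ℓ u) (ENNReal.ofReal q) volume ∧
        ∫⁻ x, ENNReal.ofReal (ρ ^ ((ℓ : ℝ) * q)) * ‖weakDeriv ℓ u x‖ₑ ^ q ≤
          C * (ENNReal.ofReal (ρ ^ (-lam)) * campanatoSeminorm lam ℓ ρ u) ^ (q - p) *
            (ENNReal.ofReal (ρ ^ (p * ((k : ℝ) + σ))) * gagliardoEnergy σ p (weakDeriv k u) +
              ∫⁻ x, ENNReal.ofReal (ρ ^ ((ℓ : ℝ) * p)) * ‖weakDeriv ℓ u x‖ₑ ^ p) := by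
  obtain ⟨m, rfl⟩ : ∃ m, k = ℓ + (m + 1) := ⟨k - 1 - ℓ, by omega⟩
  have hp0 : 0 < p := by linarith
  have hq0 : 0 < q := by linarith
  obtain ⟨K, hK⟩ := exists_ae_enorm_weakDeriv_le (N := N) ℓ m lam hp hσ0
  -- Cleared of the denominator, the upper bound on λ is equivalent to (ℓ + λ)(q - p) ≤ (m + 1 +
  -- σ)p, the exponent condition of the optimization.
  rw [le_div_iff₀ (sub_pos.2 hpq)] at hlam1
  push_cast at hlam1
  obtain ⟨C, hC⟩ := exists_ofReal_mul_enorm_rpow_le (α := ((ℓ + (m + 1) : ℕ) : ℝ) + σ)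
    (β := (m : ℝ) + 1 + σ) (δ := (ℓ : ℝ)) (lam := lam) (K := (K : ℝ)) (by linarith)
    (by positivity) hp0 hpq (by linarith) K.2 (by push_cast; ring)
  refine ⟨C, fun ρ hρ u ⟨hW, hEn⟩ ⟨_, hM⟩ => ?_⟩
  obtain ⟨hg₀, hgp⟩ := hW ℓ (by omega)
  obtain ⟨hG₀, -⟩ := hW (ℓ + (m + 1)) le_rfl
  have hgL := hg₀.2.1.aestronglyMeasurable
  have hGL := hG₀.2.1.aestronglyMeasurable
  -- A strongly measurable representative makes the local energy measurable; the total energy is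
  -- unchanged.
  set G := hGL.mk with hGdef
  have hGae : weakDeriv (ℓ + (m + 1)) u =ᵐ[volume] G := hGL.ae_eq_mk
  have hGm : StronglyMeasurable G := hGL.stronglyMeasurable_mk
  have hEe := gagliardoEnergy_congr_ae σ p hGae
  rw [hEe] at hEn ⊢
  set M := campanatoSeminorm lam ℓ ρ u
  have hfinE : ∀ᵐ x, localGagliardo σ p G x < ⊤ := by
    have := hEn
    rw [← lintegral_localGagliardo_rpow σ hp0.ne'] at this
    filter_upwards [ae_lt_top ((measurable_localGagliardo σ p hGm).pow_const p) this.ne] with x hx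
    exact (ENNReal.rpow_lt_top_iff_of_pos hp0).1 hx
  have hpt : ∀ᵐ x, ENNReal.ofReal (ρ ^ ((ℓ : ℝ) * q)) * ‖weakDeriv ℓ u x‖ₑ ^ q ≤
      C * (ENNReal.ofReal (ρ ^ (-lam)) * M) ^ (q - p) *
        (ENNReal.ofReal (ρ ^ (p * (((ℓ + (m + 1) : ℕ) : ℝ) + σ))) * localGagliardo σ p G x ^ p +
          ENNReal.ofReal (ρ ^ ((ℓ : ℝ) * p)) * ‖weakDeriv ℓ u x‖ₑ ^ p) := by
    filter_upwards [hK u _ G (hg₀.congr_ae hgL.ae_eq_mk) (hG₀.congr_ae hGae)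
      hgL.stronglyMeasurable_mk hGm hEn ρ, hgL.ae_eq_mk, hfinE] with x hx hgx hEx
    rw [hgx]
    refine hC ρ _ M _ hρ enorm_ne_top hM.ne hEx.ne fun r hr hrρ => ?_
    rw [ENNReal.ofReal_coe_nnreal]
    exact hx r hr hrρ
  have hfinC : C * (ENNReal.ofReal (ρ ^ (-lam)) * M) ^ (q - p) ≠ ⊤ :=
    ENNReal.mul_ne_top ENNReal.coe_ne_top (ENNReal.rpow_ne_top_of_nonneg (sub_pos.2 hpq).le
      (ENNReal.mul_ne_top ENNReal.ofReal_ne_top hM.ne))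
  have hineq : ∫⁻ x, ENNReal.ofReal (ρ ^ ((ℓ : ℝ) * q)) * ‖weakDeriv ℓ u x‖ₑ ^ q ≤
      C * (ENNReal.ofReal (ρ ^ (-lam)) * M) ^ (q - p) *
        (ENNReal.ofReal (ρ ^ (p * (((ℓ + (m + 1) : ℕ) : ℝ) + σ))) * gagliardoEnergy σ p G +
          ∫⁻ x, ENNReal.ofReal (ρ ^ ((ℓ : ℝ) * p)) * ‖weakDeriv ℓ u x‖ₑ ^ p) := by
    refine (lintegral_mono_ae hpt).trans (le_of_eq ?_)
    rw [lintegral_const_mul' _ _ hfinC, lintegral_add_left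
      (((measurable_localGagliardo σ p hGm).pow_const p).const_mul _),
      lintegral_const_mul' _ _ ENNReal.ofReal_ne_top, lintegral_localGagliardo_rpow σ hp0.ne']
  refine ⟨⟨hgL, ?_⟩, hineq⟩
  have hgp' : ∫⁻ x, ‖weakDeriv ℓ u x‖ₑ ^ p < ⊤ := by
    have := (eLpNorm_lt_top_iff_lintegral_rpow_enorm_lt_top (by simpa using hp0)
      ENNReal.ofReal_ne_top).1 hgp.2
    rwa [ENNReal.toReal_ofReal hp0.le] at this
  rw [eLpNorm_lt_top_iff_lintegral_rpow_enorm_lt_top (by simpa using hq0) ENNReal.ofReal_ne_top,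
    ENNReal.toReal_ofReal hq0.le]
  -- The right-hand side is finite because D^ℓ u is in L^p, so the inequality itself yields
  -- membership in L^q.
  have hlt := hineq.trans_lt (ENNReal.mul_lt_top hfinC.lt_top (ENNReal.add_lt_top.2
    ⟨ENNReal.mul_lt_top ENNReal.ofReal_lt_top hEn, by
      rw [lintegral_const_mul' _ _ ENNReal.ofReal_ne_top]
      exact ENNReal.mul_lt_top ENNReal.ofReal_lt_top hgp'⟩))
  rw [lintegral_const_mul' _ _ ENNReal.ofReal_ne_top] at hlt
  exact ENNReal.lt_top_of_mul_ne_top_right hlt.ne (by simpa using Real.rpow_pos_of_pos hρ _)
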